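/- **Definitions.** Fix an arbitrary field $\mathbb F$. For a poset $P$, an *interval* of $P$ is a nonempty, convex subset any two of whose elements are joined within it by a finite sequence of consecutively comparable elements; $\mathrm{Int}(P)$ is the set of intervals. A *$P$-module* is a functor from $P$ to finite-dimensional $\mathbb F$-vector spaces. Its *generalized rank invariant* $\mathrm{rk}_M(I)$, $I\in\mathrm{Int}(P)$, is the rank of the canonical map $\varprojlim M|_I\to\varinjlim M|_I$. Its *generalized persistence diagram* (GPD), which is unique if it exists, is the function $\mathrm{dgm}_M:\mathrm{Int}(P)\to\mathbb Z$ with $\mathrm{rk}_M(I)=\sum_{J\supseteq I}\mathrm{dgm}_M(J)$ for all $I\in\mathrm{Int}(P)$, each sum having only finitely many nonzero terms. Its *size* $\|\mathrm{dgm}_M\|$ is the cardinality of its support. For a finite metric space $(X,\mathsf d)$ and $r\ge 0$, $\mathrm{Rips}(X)_r$ is the simplicial complex of nonempty subsets of $X$ of diameter at most $r$. For a finite subset $X$ of $\mathbb R^3$ with the supremum metric, $\check{\mathrm C}\mathrm{ech}(X)_r$ is the complex of nonempty subsets of $X$ whose closed $r$-balls in $\mathbb R^3$ have a common point. For $d\in\mathbb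 Z$, the degree-Rips complex $\mathrm{DRips}(X)_{d,r}$ (degree-Čech complex $\mathrm{D}\check{\mathrm C}\mathrm{ech}(X)_{d,r}$) is the maximal subcomplex of $\mathrm{Rips}(X)_r$ (of $\check{\mathrm C}\mathrm{ech}(X)_r$) all of whose vertices have degree at least $d-1$ in the 1-skeleton of $\mathrm{Rips}(X)_r$ (of $\check{\mathrm C}\mathrm{ech}(X)_r$). These are filtrations over $\mathbb Z^{\mathrm{op}}\times\mathbb R_{\ge0}$; $\mathrm{dgm}_1$ of a filtration denotes the GPD of its simplicial homology $\mathrm H_1(-;\mathbb F)$. **Theorem (Super-polynomial GPD of Degree-Rips and Degree-Čech filtrations).** 1. There is no $k\in\mathbb Z_{\ge0}$ such that $\|\mathrm{dgm}_1(\mathrm{DRips}(X))\|=O(|X|^k)$ over all finite metric spaces $X$. 2. There is no $k\in\mathbb Z_{\ge0}$ such that $\|\mathrm{dgm}_1(\mathrm{D}\check{\mathrm C}\mathrm{ech}(X))\|=O(|X|^k)$ over all finite subsets $X$ of $\mathbb R^3$ with the supremum metric (hence none over any larger class of finite metric spaces in Euclidean spaces). 3. Explicit witnesses: let $n\ge 2$,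 $\epsilon=1/n^2$, $b_j=n+(j-n)\epsilon$ for $0\le j\le n+1$, $a=b_0$, $A=\{(1,0),(0,1),(-1,0),(0,-1)\}$, $B=\{(1,\epsilon),(-\epsilon,1),(-1,-\epsilon),(\epsilon,-1)\}$, and let $$X_n=\bigcup_{i=0}^n\Big(aA\ \cup\bigcup_{0\le j\le n,\ j\ne i}(a+b_j)A\ \cup\ (a+b_{i+1})B\Big)\times\{(n+\epsilon)i\}\subset\mathbb R^3$$ with the supremum metric. Then $|X_n|=4(n+1)(n+2)$. Let $M$ be $\mathrm H_1(\mathrm{DRips}(X_n);\mathbb F)$ and $c=1$, or let $M$ be $\mathrm H_1(\mathrm{D}\check{\mathrm C}\mathrm{ech}(X_n);\mathbb F)$ and $c=1/2$. The pullback $M'$ of $M$ to $\{0,\dots,n+1\}^2$ along $(i,j)\mapsto(n+4-i,\ c\,b_j)$ is isomorphic to the following module. For $j\le n$, its value at $(i,j)$ is $0$ if $i+j<n$, the hyperplane $\{v\in\mathbb F^{n+1}:v_i=0\}\cong\mathbb F^n$ if $i+j=n$, and $\mathbb F^{n+1}$ if $i+j>n$ (coordinates $v_0,\dots,v_n$),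 with inclusions as maps. For $j=n+1$, its value is $\mathbb F$ and the maps within this row are identities. The maps from $j\le n$ to $j=n+1$ are $v\mapsto v_0+\dots+v_n$. Moreover, the GPD of $M$ exists and has finite support, $\|\mathrm{dgm}_{M'}\|\ge 2^{n+1}-1$, and $\|\mathrm{dgm}_M\|\ge 2^{n+1}-1$. -/

import Mathlib

open scoped NNReal

set_option maxSynthPendingDepth 3

/-! ### Intervals of a poset, persistence modules, generalized rank invariant and diagram -/

/-- An interval of a poset: a nonempty, convex subset, any two elements of which are joined by a
finite sequence of consecutively comparable elements of the subset. -/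
structure IsPosetInterval {P : Type*} [PartialOrder P] (I : Set P) : Prop where
  nonempty : I.Nonempty
  convex : ∀ p ∈ I, ∀ q ∈ I, ∀ r, p ≤ r → r ≤ q → r ∈ I
  connected : ∀ p ∈ I, ∀ q ∈ I,
    Relation.ReflTransGen (fun a b => b ∈ I ∧ (a ≤ b ∨ b ≤ a)) p q

/-- The set of all intervals of a poset. -/
abbrev PosetInt (P : Type*) [PartialOrder P] : Type _ := {I : Set P // IsPosetInterval I}

section PersistenceModules

universe w u v

/-- A persistence module over the poset `P`: a functor from `P` (as a category) to
finite-dimensional vector spaces over `F`. -/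
structure PersistenceModule (F : Type u) [Field F] (P : Type v) [PartialOrder P] where
  obj : P → Type w
  [addCommGroup : ∀ p, AddCommGroup (obj p)]
  [module : ∀ p, Module F (obj p)]
  [finiteDimensional : ∀ p, FiniteDimensional F (obj p)]
  map : ∀ {p q : P}, p ≤ q → obj p →ₗ[F] obj q
  map_id : ∀ (p : P) (x : obj p), map (le_refl p) x = x
  map_comp : ∀ {p q r : P} (h : p ≤ q) (h' : q ≤ r) (x : obj p),
    map (h.trans h') x = map h' (map h x)

attribute [instance] PersistenceModule.addCommGroup PersistenceModule.module
  PersistenceModule.finiteDimensional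

/-- The limit of the restriction of `M` to a subset `I`: the space of sections over `I`. -/
def pmLimit {F : Type u} [Field F] {P : Type v} [PartialOrder P] (M : PersistenceModule.{w} F P)
    (I : Set P) : Submodule F (∀ p : I, M.obj p.1) where
  carrier := {l | ∀ (p q : I) (h : p.1 ≤ q.1), M.map h (l p) = l q}
  add_mem' := by
    intro a b ha hb p q h
    simp [ha p q h, hb p q h]
  zero_mem' := by
    intro p q h
    simp
  smul_mem' := by
    intro c a ha p q h
    simp [ha p q h]

/-- The projection from the limit of `M` restricted to `I` to the value at a point of `I`. -/
def pmLimitProj {F : Type u} [Field F] {P : Type v} [PartialOrder P] (M : PersistenceModule.{w} F P)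
    (I : Set P) (p : I) : pmLimit M I →ₗ[F] M.obj p.1 :=
  (LinearMap.proj p).comp (pmLimit M I).subtype

open Classical in
/-- The colimit of the restriction of `M` to a subset `I` (Mathlib's `Module.DirectLimit` is the
colimit over an arbitrary preorder, directed or not). -/
def PmColimit {F : Type u} [Field F] {P : Type v} [PartialOrder P] (M : PersistenceModule.{w} F P)
    (I : Set P) : Type _ :=
  Module.DirectLimit (fun p : I => M.obj p.1) (fun p q h => M.map (show p.1 ≤ q.1 from h))

open Classical in
noncomputable instance {F : Type u} [Field F] {P : Type v} [PartialOrder P]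
    (M : PersistenceModule.{w} F P) (I : Set P) : AddCommGroup (PmColimit M I) :=
  Module.DirectLimit.addCommGroup (fun p : I => M.obj p.1)
    (fun p q h => M.map (show p.1 ≤ q.1 from h))

open Classical in
noncomputable instance {F : Type u} [Field F] {P : Type v} [PartialOrder P]
    (M : PersistenceModule.{w} F P) (I : Set P) : Module F (PmColimit M I) :=
  Module.DirectLimit.module (fun p : I => M.obj p.1)
    (fun p q h => M.map (show p.1 ≤ q.1 from h))

open Classical in
/-- The inclusion of the value at a point of `I` into the colimit of `M` restricted to `I`. -/
noncomputable def pmColimitIncl {F : Type u} [Field F] {P : Type v} [PartialOrder P]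
    (M : PersistenceModule.{w} F P) (I : Set P) (p : I) : M.obj p.1 →ₗ[F] PmColimit M I :=
  Module.DirectLimit.of F I (fun p : I => M.obj p.1)
    (fun p q h => M.map (show p.1 ≤ q.1 from h)) p

theorem pmColimitIncl_map {F : Type u} [Field F] {P : Type v} [PartialOrder P]
    (M : PersistenceModule.{w} F P) (I : Set P) {a b : I} (h : a.1 ≤ b.1) (x : M.obj a.1) :
    pmColimitIncl M I b (M.map h x) = pmColimitIncl M I a x := by
  classical
  exact Module.DirectLimit.of_f (G := fun p : I => M.obj p.1)
    (f := fun p q h => M.map (show p.1 ≤ q.1 from h)) (hij := h)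

/-- The limit-to-colimit map through the point `p` of the interval `I`. -/
noncomputable def pmLimToColim {F : Type u} [Field F] {P : Type v} [PartialOrder P]
    (M : PersistenceModule.{w} F P) (I : Set P) (p : I) : pmLimit M I →ₗ[F] PmColimit M I :=
  (pmColimitIncl M I p).comp (pmLimitProj M I p)

/-- The limit-to-colimit map over an interval does not depend on the point. -/
theorem pmLimToColim_eq {F : Type u} [Field F] {P : Type v} [PartialOrder P]
    (M : PersistenceModule.{w} F P) (I : PosetInt P) (p q : I.1) :
    pmLimToColim M I.1 p = pmLimToColim M I.1 q := by
  have step : ∀ a b : I.1, a.1 ≤ b.1 → pmLimToColim M I.1 a = pmLimToColim M I.1 b := by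
    intro a b h
    ext l
    have h1 : pmLimitProj M I.1 b l = M.map h (pmLimitProj M I.1 a l) := (l.2 a b h).symm
    simp only [pmLimToColim, LinearMap.comp_apply, h1]
    exact (pmColimitIncl_map M I.1 h _).symm
  have key : ∀ y : P, Relation.ReflTransGen (fun a b => b ∈ I.1 ∧ (a ≤ b ∨ b ≤ a)) p.1 y →
      ∃ hy : y ∈ I.1, pmLimToColim M I.1 p = pmLimToColim M I.1 ⟨y, hy⟩ := by
    intro y hy
    induction hy with
    | refl => exact ⟨p.2, rfl⟩
    | tail _ hbc ih =>
      obtain ⟨hb, e⟩ := ih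
      refine ⟨hbc.1, e.trans ?_⟩
      rcases hbc.2 with h | h
      · exact step _ _ h
      · exact (step _ _ h).symm
  obtain ⟨_, e⟩ := key q.1 (I.2.connected p.1 p.2 q.1 q.2)
  exact e

/-- The generalized rank invariant: the rank of the canonical limit-to-colimit map of the
restriction of `M` to the interval `I`. -/
noncomputable def genRank {F : Type u} [Field F] {P : Type v} [PartialOrder P]
    (M : PersistenceModule.{w} F P) (I : PosetInt P) : ℕ :=
  Module.finrank F (LinearMap.range
    (pmLimToColim M I.1 ⟨I.2.nonempty.some, I.2.nonempty.some_mem⟩))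

/-- `f` is a generalized persistence diagram of `M`: for every interval `I`, the sum of `f` over
the intervals `J ⊇ I` has only finitely many nonzero summands and equals the rank over `I`. -/
def IsGPD {F : Type u} [Field F] {P : Type v} [PartialOrder P] (M : PersistenceModule.{w} F P)
    (f : PosetInt P → ℤ) : Prop :=
  ∀ I : PosetInt P, {J : PosetInt P | I.1 ⊆ J.1 ∧ f J ≠ 0}.Finite ∧
    (genRank M I : ℤ) = ∑ᶠ (J : PosetInt P) (_ : I.1 ⊆ J.1), f J

/-- A persistence module has at most one generalized persistence diagram. -/
theorem IsGPD.unique {F : Type u} [Field F] {P : Type v} [PartialOrder P]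
    {M : PersistenceModule.{w} F P} {f g : PosetInt P → ℤ} (hf : IsGPD M f) (hg : IsGPD M g) :
    f = g := by
  by_contra hne
  obtain ⟨I, hI⟩ := Function.ne_iff.mp hne
  have hfin : {J : PosetInt P | I.1 ⊆ J.1 ∧ f J ≠ g J}.Finite := by
    refine ((hf I).1.union (hg I).1).subset ?_
    rintro J ⟨h1, h2⟩
    by_cases h : f J = 0
    · exact Or.inr ⟨h1, fun h' => h2 (h.trans h'.symm)⟩
    · exact Or.inl ⟨h1, h⟩
  obtain ⟨K, hK⟩ := hfin.exists_maximal ⟨I, subset_rfl, hI⟩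
  have hKI := hK.prop
  have hKmax : ∀ J : PosetInt P, K.1 ⊆ J.1 → J ≠ K → f J = g J := by
    intro J h1 h2
    by_contra h3
    exact h2 (le_antisymm (hK.le_of_ge (y := J) ⟨hKI.1.trans h1, h3⟩ h1) h1)
  have e : ∑ᶠ (J : PosetInt P) (_ : K.1 ⊆ J.1), f J
      = ∑ᶠ (J : PosetInt P) (_ : K.1 ⊆ J.1), g J := (hf K).2.symm.trans (hg K).2
  have expand : ∀ h : PosetInt P → ℤ, {J : PosetInt P | K.1 ⊆ J.1 ∧ h J ≠ 0}.Finite →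
      ∑ᶠ (J : PosetInt P) (_ : K.1 ⊆ J.1), h J
        = h K + ∑ᶠ (J : PosetInt P) (_ : K.1 ⊆ J.1 ∧ J ≠ K), h J := by
    intro h hh
    have hs : {J : PosetInt P | K.1 ⊆ J.1} = insert K {J : PosetInt P | K.1 ⊆ J.1 ∧ J ≠ K} := by
      ext J
      by_cases hJ : J = K
      · simp [hJ]
      · simp [hJ]
    have := finsum_mem_insert' (f := h) (a := K) (s := {J : PosetInt P | K.1 ⊆ J.1 ∧ J ≠ K})
      (by simp) (hh.subset (fun J hJ => ⟨hJ.1.1, hJ.2⟩))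
    rw [← hs] at this
    exact this
  rw [expand f (hf K).1, expand g (hg K).1] at e
  have e2 : ∑ᶠ (J : PosetInt P) (_ : K.1 ⊆ J.1 ∧ J ≠ K), f J
      = ∑ᶠ (J : PosetInt P) (_ : K.1 ⊆ J.1 ∧ J ≠ K), g J :=
    finsum_congr fun J => finsum_congr fun hJ => hKmax J hJ.1 hJ.2
  rw [e2] at e
  exact hKI.2 (add_right_cancel e)

open Classical in
/-- The generalized persistence diagram of `M` (zero if it does not exist). -/
noncomputable def gpd {F : Type u} [Field F] {P : Type v} [PartialOrder P]
    (M : PersistenceModule.{w} F P) : PosetInt P → ℤ :=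
  if h : ∃ f, IsGPD M f then h.choose else 0

/-- The size of the generalized persistence diagram: the cardinality of its support. If the
diagram does not exist or its support is infinite this is `0`, so that a positive lower bound on
the size includes the existence of the diagram and the finiteness of its support. -/
noncomputable def gpdSize {F : Type u} [Field F] {P : Type v} [PartialOrder P]
    (M : PersistenceModule.{w} F P) : ℕ :=
  (Function.support (gpd M)).ncard

end PersistenceModules

/-! ### Simplicial homology of abstract simplicial complexes -/

section Homology

universe u v

/-- The tuple `s` of vertices spans a simplex of `K` (repetitions are allowed). -/
def SpansSimplex {V : Type v} (K : PreAbstractSimplicialComplex V) {m : ℕ} (s : Fin m → V) :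
    Prop :=
  ∃ σ ∈ K, (σ : Set V) = Set.range s

/-- Formal linear combinations of tuples of `m + 1` vertices that span simplices of `K`. -/
noncomputable def tupleChains (F : Type u) [Field F] {V : Type v} (K : PreAbstractSimplicialComplex V) (m : ℕ) :
    Submodule F ((Fin (m + 1) → V) →₀ F) :=
  Finsupp.supported F F {s | SpansSimplex K s}

/-- The orientation relations in degree `m`: a tuple with a repeated vertex is zero, and permuting
the vertices of a tuple multiplies it by the sign of the permutation. The quotient
`tupleChains F K m ⧸ orientationRel F K m` is the space of oriented simplicial `m`-chains. -/
noncomputable def orientationRel (F : Type u) [Field F] {V : Type v} (K : PreAbstractSimplicialComplex V)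
    (m : ℕ) : Submodule F ((Fin (m + 1) → V) →₀ F) :=
  Submodule.span F
    ({x | ∃ s : Fin (m + 1) → V, SpansSimplex K s ∧ ¬ Function.Injective s ∧
        x = Finsupp.single s 1} ∪
      {x | ∃ (s : Fin (m + 1) → V) (π : Equiv.Perm (Fin (m + 1))), SpansSimplex K s ∧
        x = Finsupp.single (s ∘ π) 1 - ((Equiv.Perm.sign π : ℤ) : F) • Finsupp.single s 1})

/-- The boundary operator from degree `m + 1` to degree `m`,
`[v₀, …, vₘ₊₁] ↦ ∑ i, (-1) ^ i [v₀, …, v̂ᵢ, …, vₘ₊₁]`. -/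
noncomputable def simplicialBoundary (F : Type u) [Field F] (V : Type v) (m : ℕ) :
    ((Fin (m + 1 + 1) → V) →₀ F) →ₗ[F] ((Fin (m + 1) → V) →₀ F) :=
  ∑ i : Fin (m + 1 + 1), (-1 : F) ^ (i : ℕ) •
    Finsupp.lmapDomain F F (fun s : Fin (m + 1 + 1) → V => s ∘ i.succAbove)

/-- Representatives of `m`-cycles: chains of `K` whose boundary is zero as an oriented chain. -/
noncomputable def simplicialCycles (F : Type u) [Field F] {V : Type v} (K : PreAbstractSimplicialComplex V) :
    (m : ℕ) → Submodule F ((Fin (m + 1) → V) →₀ F)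
  | 0 => tupleChains F K 0
  | m + 1 => tupleChains F K (m + 1) ⊓ (orientationRel F K m).comap (simplicialBoundary F V m)

/-- Representatives of `m`-boundaries: boundaries of `(m + 1)`-chains of `K`, up to the
orientation relations. -/
noncomputable def simplicialBoundaries (F : Type u) [Field F] {V : Type v}
    (K : PreAbstractSimplicialComplex V) (m : ℕ) : Submodule F ((Fin (m + 1) → V) →₀ F) :=
  (tupleChains F K (m + 1)).map (simplicialBoundary F V m) ⊔ orientationRel F K m

/-- The simplicial homology `H_m(K; F)`: cycles modulo boundaries in the oriented chain complex. -/
abbrev SimplicialHomology (F : Type u) [Field F] {V : Type v} (K : PreAbstractSimplicialComplex V)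
    (m : ℕ) : Type (max u v) :=
  simplicialCycles F K m ⧸ (simplicialBoundaries F K m).submoduleOf (simplicialCycles F K m)

theorem SpansSimplex.mono {V : Type v} {K L : PreAbstractSimplicialComplex V} (h : K ≤ L) {m : ℕ}
    {s : Fin m → V} (hs : SpansSimplex K s) : SpansSimplex L s := by
  obtain ⟨σ, hσ, e⟩ := hs
  exact ⟨σ, h hσ, e⟩

theorem tupleChains_mono (F : Type u) [Field F] {V : Type v}
    {K L : PreAbstractSimplicialComplex V} (h : K ≤ L) (m : ℕ) :
    tupleChains F K m ≤ tupleChains F L m :=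
  Finsupp.supported_mono fun _ hs => SpansSimplex.mono h hs

theorem orientationRel_mono (F : Type u) [Field F] {V : Type v}
    {K L : PreAbstractSimplicialComplex V} (h : K ≤ L) (m : ℕ) :
    orientationRel F K m ≤ orientationRel F L m := by
  refine Submodule.span_mono (Set.union_subset_union ?_ ?_)
  · rintro x ⟨s, hs, hx⟩
    exact ⟨s, hs.mono h, hx⟩
  · rintro x ⟨s, π, hs, hx⟩
    exact ⟨s, π, hs.mono h, hx⟩

theorem simplicialCycles_mono (F : Type u) [Field F] {V : Type v}
    {K L : PreAbstractSimplicialComplex V} (h : K ≤ L) (m : ℕ) :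
    simplicialCycles F K m ≤ simplicialCycles F L m := by
  cases m with
  | zero => exact tupleChains_mono F h 0
  | succ m =>
    exact inf_le_inf (tupleChains_mono F h _) (Submodule.comap_mono (orientationRel_mono F h m))

theorem simplicialBoundaries_mono (F : Type u) [Field F] {V : Type v}
    {K L : PreAbstractSimplicialComplex V} (h : K ≤ L) (m : ℕ) :
    simplicialBoundaries F K m ≤ simplicialBoundaries F L m :=
  sup_le_sup (Submodule.map_mono (tupleChains_mono F h _)) (orientationRel_mono F h m)

/-- The map in homology induced by the inclusion of a subcomplex. -/
noncomputable def simplicialHomologyMap (F : Type u) [Field F] {V : Type v}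
    {K L : PreAbstractSimplicialComplex V} (h : K ≤ L) (m : ℕ) :
    SimplicialHomology F K m →ₗ[F] SimplicialHomology F L m :=
  Submodule.mapQ _ _ (Submodule.inclusion (simplicialCycles_mono F h m))
    (fun _ hx => simplicialBoundaries_mono F h m hx)

/-- The persistence module `H_m(𝓕; F)` of a simplicial filtration `𝓕` on a finite vertex set,
indexed by a poset. -/
noncomputable def filtrationHomology (F : Type u) [Field F] {V : Type v} [Finite V] {P : Type*}
    [PartialOrder P] (𝓕 : P →o PreAbstractSimplicialComplex V) (m : ℕ) :
    PersistenceModule.{max u v} F P where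
  obj p := SimplicialHomology F (𝓕 p) m
  map h := simplicialHomologyMap F (𝓕.monotone h) m
  map_id p x := by
    obtain ⟨x, rfl⟩ := Submodule.Quotient.mk_surjective _ x
    rfl
  map_comp h h' x := by
    obtain ⟨x, rfl⟩ := Submodule.Quotient.mk_surjective _ x
    rfl

end Homology

/-! ### Degree-Rips and degree-Čech bifiltrations -/

/-- The Vietoris–Rips filtration of a metric space: at scale `r`, the nonempty finite sets of
points at pairwise distance at most `r`. -/
def ripsFiltration (X : Type*) [MetricSpace X] : ℝ≥0 →o PreAbstractSimplicialComplex X where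
  toFun r :=
    { faces := {σ | σ.Nonempty ∧ ∀ x ∈ σ, ∀ y ∈ σ, dist x y ≤ r}
      isRelLowerSet_faces := fun {_} hσ =>
        ⟨hσ.1, fun _ hτσ hτ => ⟨hτ, fun x hx y hy => hσ.2 x (hτσ hx) y (hτσ hy)⟩⟩ }
  monotone' := fun _ _ hrs _ hσ =>
    ⟨hσ.1, fun x hx y hy => (hσ.2 x hx y hy).trans (NNReal.coe_le_coe.mpr hrs)⟩

/-- The Čech filtration of a finite subset `X` of a metric space `E`: at scale `r`, the nonempty
sets of points of `X` whose closed `r`-balls in `E` have a common point. -/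
def cechFiltration {E : Type*} [MetricSpace E] (X : Finset E) :
    ℝ≥0 →o PreAbstractSimplicialComplex X where
  toFun r :=
    { faces := {σ | σ.Nonempty ∧ (⋂ x ∈ σ, Metric.closedBall (x : E) r).Nonempty}
      isRelLowerSet_faces := fun {_} hσ =>
        ⟨hσ.1, fun _ hτσ hτ => ⟨hτ, hσ.2.mono (Set.biInter_subset_biInter_left hτσ)⟩⟩ }
  monotone' := fun _ _ hrs _ hσ =>
    ⟨hσ.1, hσ.2.mono (Set.iInter₂_mono fun _ _ =>
      Metric.closedBall_subset_closedBall (NNReal.coe_le_coe.mpr hrs))⟩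

/-- The neighbours of the vertex `x` in the 1-skeleton of `K`. -/
def complexNeighbors {V : Type*} (K : PreAbstractSimplicialComplex V) (x : V) : Set V :=
  {y | y ≠ x ∧ ∃ σ ∈ K, (σ : Set V) = {x, y}}

/-- The degree bifiltration of a filtration `K` by complexes on a finite set: at degree `d` and
scale `r`, the maximal subcomplex of `K r` whose vertices have degree at least `d - 1` in the
1-skeleton of `K r`. It is indexed by `ℤᵒᵖ × ℝ≥0` (larger degrees come first). -/
def degreeBifiltration {V : Type*} [Finite V] (K : ℝ≥0 →o PreAbstractSimplicialComplex V) :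
    ℤᵒᵈ × ℝ≥0 →o PreAbstractSimplicialComplex V where
  toFun p :=
    { faces := {σ | σ ∈ K p.2 ∧
        ∀ x ∈ σ, OrderDual.ofDual p.1 - 1 ≤ ((complexNeighbors (K p.2) x).ncard : ℤ)}
      isRelLowerSet_faces := fun {_} hσ =>
        ⟨((K p.2).isRelLowerSet_faces hσ.1).1, fun _ hτσ hτ =>
          ⟨((K p.2).isRelLowerSet_faces hσ.1).2 hτσ hτ, fun x hx => hσ.2 x (hτσ hx)⟩⟩ }
  monotone' := by
    rintro ⟨d, r⟩ ⟨e, s⟩ ⟨hde, hrs⟩ σ hσ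
    refine ⟨K.monotone hrs hσ.1, fun x hx => ?_⟩
    have h1 : OrderDual.ofDual e ≤ OrderDual.ofDual d := hde
    have h2 : (complexNeighbors (K r) x).ncard ≤ (complexNeighbors (K s) x).ncard := by
      refine Set.ncard_le_ncard ?_ (Set.toFinite _)
      rintro y ⟨hy, τ, hτ, e⟩
      exact ⟨hy, τ, K.monotone hrs hτ, e⟩
    have h3 : OrderDual.ofDual d - 1 ≤ ((complexNeighbors (K r) x).ncard : ℤ) := hσ.2 x hx
    have h4 : ((complexNeighbors (K r) x).ncard : ℤ) ≤ (complexNeighbors (K s) x).ncard := by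
      exact_mod_cast h2
    show OrderDual.ofDual e - 1 ≤ ((complexNeighbors (K s) x).ncard : ℤ)
    linarith

/-- The degree-Rips bifiltration of a finite metric space. -/
def degreeRips (X : Type*) [MetricSpace X] [Finite X] :
    ℤᵒᵈ × ℝ≥0 →o PreAbstractSimplicialComplex X :=
  degreeBifiltration (ripsFiltration X)

/-- The degree-Čech bifiltration of a finite subset of a metric space. -/
def degreeCech {E : Type*} [MetricSpace E] (X : Finset E) :
    ℤᵒᵈ × ℝ≥0 →o PreAbstractSimplicialComplex X :=
  degreeBifiltration (cechFiltration X)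

/-! ### The explicit point sets

`Fin 3 → ℝ` carries the supremum metric. -/

/-- `b_j = n + (j - n) / n²`. -/
noncomputable def scaleB (n j : ℕ) : ℝ := n + ((j : ℝ) - n) * (1 / (n : ℝ) ^ 2)

/-- The point of `ℝ³` with horizontal part `t • u` and height `z`. -/
def spacePoint (t : ℝ) (u : ℝ × ℝ) (z : ℝ) : Fin 3 → ℝ := ![t * u.1, t * u.2, z]

/-- The four axis directions. -/
def dirA : Fin 4 → ℝ × ℝ := ![(1, 0), (0, 1), (-1, 0), (0, -1)]

/-- The four slightly rotated axis directions. -/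
def dirB (ε : ℝ) : Fin 4 → ℝ × ℝ := ![(1, ε), (-ε, 1), (-1, -ε), (ε, -1)]

/-- The point set `X_n`: with `ε = 1 / n²` and `a = b_0 = n - n ε`, its layer at height
`(n + ε) i`, for `0 ≤ i ≤ n`, has horizontal part
`a A ∪ ⋃_{0 ≤ j ≤ n, j ≠ i} (a + b_j) A ∪ (a + b_{i+1}) B`. -/
noncomputable def witnessSet (n : ℕ) : Finset (Fin 3 → ℝ) :=
  (Finset.range (n + 1)).biUnion fun i =>
    let ε : ℝ := 1 / (n : ℝ) ^ 2
    let z : ℝ := (n + ε) * i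
    let a : ℝ := scaleB n 0
    (Finset.univ.image fun q => spacePoint a (dirA q) z) ∪
      (((Finset.range (n + 1)).erase i).biUnion fun j =>
        Finset.univ.image fun q => spacePoint (a + scaleB n j) (dirA q) z) ∪
      (Finset.univ.image fun q => spacePoint (a + scaleB n (i + 1)) (dirB ε q) z)

/-! ### The subgrid and the zigzag structure -/

/-- The subgrid of `ℤᵒᵖ × ℝ≥0` given by the degrees `n + 4 < n + 3 < ⋯ < 3` (in `ℤᵒᵖ`) and the
scales `c b_0 < c b_1 < ⋯ < c b_{n+1}`: the point `(i, j)` goes to `(n + 4 - i, c b_j)`. -/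
noncomputable def subgrid (n : ℕ) (c : ℝ≥0) : Fin (n + 2) × Fin (n + 2) →o ℤᵒᵈ × ℝ≥0 where
  toFun p := (OrderDual.toDual ((n : ℤ) + 4 - (p.1 : ℕ)), c * (scaleB n p.2).toNNReal)
  monotone' := by
    rintro ⟨i, j⟩ ⟨i', j'⟩ ⟨hi, hj⟩
    refine ⟨?_, ?_⟩
    · have h : (i : ℕ) ≤ (i' : ℕ) := hi
      show ((n : ℤ) + 4 - (i' : ℕ)) ≤ ((n : ℤ) + 4 - (i : ℕ))
      have h' : ((i : ℕ) : ℤ) ≤ ((i' : ℕ) : ℤ) := by exact_mod_cast h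
      linarith
    · have h : (j : ℕ) ≤ (j' : ℕ) := hj
      have h' : ((j : ℕ) : ℝ) ≤ ((j' : ℕ) : ℝ) := by exact_mod_cast h
      refine mul_le_mul_right (Real.toNNReal_le_toNNReal ?_) _
      unfold scaleB
      have : (0 : ℝ) ≤ 1 / (n : ℝ) ^ 2 := by positivity
      nlinarith [mul_le_mul_of_nonneg_right h' this]

/-- The restriction of a persistence module along a monotone map of posets. -/
def PersistenceModule.restrict {F : Type*} [Field F] {P Q : Type*} [PartialOrder P]
    [PartialOrder Q] (M : PersistenceModule F Q) (g : P →o Q) : PersistenceModule F P where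
  obj p := M.obj (g p)
  map h := M.map (g.monotone h)
  map_id p x := M.map_id (g p) x
  map_comp h h' x := M.map_comp (g.monotone h) (g.monotone h') x

/-- `N` is isomorphic to the following module over `{0, …, n+1}²`. In the rows `j ≤ n` its value
at `(i, j)` is `0` if `i + j < n`, the hyperplane `{v : v_i = 0}` of `F^{n+1}` (that is, the image
of the `i`-th coordinate inclusion of `F^n`) if `i + j = n`, and `F^{n+1}` if `i + j > n`, and the
maps between these rows are the inclusions. In the row `j = n + 1` its value is `F` and the maps
are identities, and the maps into that row send `v` to `v_0 + ⋯ + v_n`. -/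
def HasZigzagStructure {F : Type*} [Field F] (n : ℕ)
    (N : PersistenceModule F (Fin (n + 2) × Fin (n + 2))) : Prop :=
  ∃ (φ : ∀ p, N.obj p →ₗ[F] (Fin (n + 1) → F)) (ψ : ∀ p, N.obj p →ₗ[F] F),
    (∀ p : Fin (n + 2) × Fin (n + 2), (p.2 : ℕ) ≤ n →
      Function.Injective (φ p) ∧
      ∀ v : Fin (n + 1) → F, v ∈ LinearMap.range (φ p) ↔
        ((p.1 : ℕ) + p.2 < n → v = 0) ∧
        ((p.1 : ℕ) + p.2 = n → ∀ k : Fin (n + 1), (k : ℕ) = p.1 → v k = 0)) ∧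
    (∀ p : Fin (n + 2) × Fin (n + 2), (p.2 : ℕ) = n + 1 → Function.Bijective (ψ p)) ∧
    (∀ (p q : Fin (n + 2) × Fin (n + 2)) (h : p ≤ q), (q.2 : ℕ) ≤ n →
      ∀ x, φ q (N.map h x) = φ p x) ∧
    (∀ (p q : Fin (n + 2) × Fin (n + 2)) (h : p ≤ q), (p.2 : ℕ) ≤ n → (q.2 : ℕ) = n + 1 →
      ∀ x, ψ q (N.map h x) = ∑ k, φ p x k) ∧
    (∀ (p q : Fin (n + 2) × Fin (n + 2)) (h : p ≤ q), (p.2 : ℕ) = n + 1 →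
      ∀ x, ψ q (N.map h x) = ψ p x)

/-! The exponential size comes from inclusion–exclusion over the missing points of an antidiagonal.
In the zigzag module the antidiagonal carries the `n + 1` coordinate hyperplanes, the points above
it carry `F^(n+1)`, and the last row carries `F`, reached by summing coordinates. For a set `U` of
indices, consider the interval below the top corner generated by an apex with value `F^(n+1)` and by
the antidiagonal points outside `U`. It has a greatest element, so its colimit is `F`. A section
over it is a vector supported in `U`, so the rank is `0` for `U = ∅` and `1` otherwise
(`genRank_zigzagInterval`). An interval contains this one exactly when it contains the two fixed
points and misses only antidiagonal points with index in `U`. Grouping the diagram by the set of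
missed points and inverting over subsets gives the total `±1` for every nonempty `U`
(`eq_of_sum_powerset_eq_ite`). Hence each of the `2^(n+1) - 1` nonempty sets is realised by an
interval in the support (`two_pow_le_ncard_support`). The argument only uses a grid inside the poset
on which suprema are preserved, so it applies both to the pullback and to the full module.

Existence and finiteness of the diagram: a degree bifiltration factors through a product of two
monotone maps with finite range, since degrees may be truncated and a finite vertex set carries
finitely many complexes. Generalized ranks of such a pullback depend only on the saturation of the
interval under the fibres (`IsIntervalSaturated.genRank_saturation`). There are finitely many
saturated intervals, and Möbius inversion over them yields the diagram.

The witness realises the zigzag module as follows. Each layer has an inner 4-cycle and, in each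
direction, a clique of outer points that attach to the inner point one scale at a time; in layer `i`
the point due at scale `i` is one scale late. The degree of inner points therefore drops out of step
at exactly one scale per layer, which removes one layer's square on the antidiagonal. At the last
scale consecutive layers become adjacent and all squares become homologous. Homology is computed
dually: cocycles are classified up to coboundary (`exists_potential_of_le`,
`exists_potential_of_eq`), and the square classes provide enough elements. For the supremum metric a
Čech complex is a Rips complex at twice the scale, which transfers everything to degree-Čech. -/

/-! ### Intervals and pullbacks of persistence modules -/

section FiberPaths

/-- A step inside `I` which goes up, or goes down within a fibre of `ρ`. -/
def FiberStep {P Q : Type*} [PartialOrder P] [PartialOrder Q] (ρ : P →o Q) (I : Set P)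
    (p q : P) : Prop :=
  p ∈ I ∧ q ∈ I ∧ (p ≤ q ∨ (q ≤ p ∧ ρ p = ρ q))

variable {α β A B : Type*} [LinearOrder α] [LinearOrder β] [PartialOrder A] [PartialOrder B]

theorem IsPosetInterval.preimage_swap {I : Set (α × β)} (hI : IsPosetInterval I) :
    IsPosetInterval (Prod.swap ⁻¹' I) where
  nonempty := by
    obtain ⟨p, hp⟩ := hI.nonempty
    exact ⟨p.swap, by simpa using hp⟩
  convex p hp q hq r hpr hrq :=
    hI.convex _ hp _ hq r.swap (Prod.swap_le_swap.mpr hpr) (Prod.swap_le_swap.mpr hrq)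
  connected p hp q hq := by
    have := (hI.connected _ hp _ hq).lift Prod.swap
      (p := fun a b => b ∈ Prod.swap ⁻¹' I ∧ (a ≤ b ∨ b ≤ a)) (by
        rintro a b ⟨hb, h⟩
        refine ⟨by simpa using hb, ?_⟩
        simpa only [Prod.swap_le_swap] using h)
    exact this

/-- In an interval of a product of two chains, a point `p` can be joined to every intermediate
first coordinate on the way to a point `q` on its lower right, staying at intermediate heights. -/
theorem IsPosetInterval.exists_fiberPath {I : Set (α × β)} (hI : IsPosetInterval I)
    (ρ₁ : α →o A) (ρ₂ : β →o B) {p q : α × β} (hp : p ∈ I) (hq : q ∈ I) (h1 : p.1 ≤ q.1)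
    (h2 : q.2 ≤ p.2) (e : ρ₂ p.2 = ρ₂ q.2) {c : α} (hc : p.1 ≤ c) (hc' : c ≤ q.1) :
    ∃ z ∈ I, z.1 = c ∧ q.2 ≤ z.2 ∧ z.2 ≤ p.2 ∧
      Relation.ReflTransGen (FiberStep (ρ₁.prodMap ρ₂) I) p z := by
  have hρ : ∀ x y, q.2 ≤ x → x ≤ p.2 → q.2 ≤ y → y ≤ p.2 → ρ₂ x = ρ₂ y := by
    have : ∀ x, q.2 ≤ x → x ≤ p.2 → ρ₂ x = ρ₂ q.2 := fun x hx hx' =>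
      le_antisymm (e ▸ ρ₂.monotone hx') (ρ₂.monotone hx)
    intro x y hx hx' hy hy'
    rw [this x hx hx', this y hy hy']
  -- Clamping to the rectangle with upper left corner `p` and lower right corner `q`; by `hρ` the
  -- map `ρ₂` is constant on its heights, so vertical moves inside it stay in a fibre.
  let cl : α × β → α × β := fun x => (max p.1 (min x.1 q.1), max q.2 (min x.2 p.2))
  have clmono : ∀ {x y}, x ≤ y → cl x ≤ cl y := by
    rintro x y ⟨hx, hy⟩
    exact ⟨max_le_max le_rfl (min_le_min hx le_rfl), max_le_max le_rfl (min_le_min hy le_rfl)⟩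
  have cl2 : ∀ x, q.2 ≤ (cl x).2 ∧ (cl x).2 ≤ p.2 := fun x =>
    ⟨le_max_left _ _, max_le h2 (min_le_right _ _)⟩
  have cl1 : ∀ x, p.1 ≤ (cl x).1 ∧ (cl x).1 ≤ q.1 := fun x =>
    ⟨le_max_left _ _, max_le h1 (min_le_right _ _)⟩
  -- One of `x`, `p`, `q` lies below the clamped point and one lies above it, so convexity applies.
  have clI : ∀ x ∈ I, cl x ∈ I := by
    intro x hx
    have hl : ∃ l ∈ I, l ≤ cl x := by
      rcases le_total q.1 x.1 with h | h
      · exact ⟨q, hq, by simp only [cl, min_eq_right h]; exact le_max_right _ _, (cl2 x).1⟩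
      rcases le_total p.2 x.2 with h' | h'
      · exact ⟨p, hp, (cl1 x).1, by simp only [cl, min_eq_right h']; exact le_max_right _ _⟩
      · refine ⟨x, hx, ?_, ?_⟩
        · simp only [cl, min_eq_left h]; exact le_max_right _ _
        · simp only [cl, min_eq_left h']; exact le_max_right _ _
    have hu : ∃ u ∈ I, cl x ≤ u := by
      rcases le_total x.1 p.1 with h | h
      · exact ⟨p, hp, max_le le_rfl ((min_le_left _ _).trans h), (cl2 x).2⟩
      rcases le_total x.2 q.2 with h' | h'
      · exact ⟨q, hq, (cl1 x).2, max_le le_rfl ((min_le_left _ _).trans h')⟩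
      · exact ⟨x, hx, max_le h (min_le_left _ _), max_le h' (min_le_left _ _)⟩
    obtain ⟨l, hl, hl'⟩ := hl
    obtain ⟨u, hu, hu'⟩ := hu
    exact hI.convex l hl u hu _ hl' hu'
  -- Invariant along a walk from `p` in `I`: every first coordinate up to that of the clamped
  -- current point is already reachable. Only upward steps can extend this range; the extension
  -- moves vertically in a fibre to the clamped point and then to the right.
  have main : ∀ t, Relation.ReflTransGen (fun a b => b ∈ I ∧ (a ≤ b ∨ b ≤ a)) p t →
      t ∈ I ∧ ∀ c, p.1 ≤ c → c ≤ (cl t).1 → ∃ z ∈ I, z.1 = c ∧ q.2 ≤ z.2 ∧ z.2 ≤ p.2 ∧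
        Relation.ReflTransGen (FiberStep (ρ₁.prodMap ρ₂) I) p z := by
    intro t ht
    induction ht with
    | refl =>
      refine ⟨hp, fun c hc hc' => ⟨p, hp, ?_, h2, le_rfl, .refl⟩⟩
      exact le_antisymm hc (hc'.trans (max_le le_rfl (min_le_left _ _)))
    | @tail t t' _ htt' ih =>
      obtain ⟨htI, ih⟩ := ih
      refine ⟨htt'.1, fun c hc hc' => ?_⟩
      rcases le_or_gt c (cl t).1 with h | h
      · exact ih c hc h
      have hle : t ≤ t' := htt'.2.resolve_right fun h' =>
        absurd (hc'.trans (clmono h').1) (not_le.mpr h)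
      obtain ⟨z', hz', e', hb, hb', hpath⟩ := ih _ (cl1 t).1 le_rfl
      have htcI := clI t htI
      have hzI : (c, (cl t).2) ∈ I :=
        hI.convex _ htcI _ (clI t' htt'.1) _ ⟨h.le, le_rfl⟩ ⟨hc', (clmono hle).2⟩
      refine ⟨(c, (cl t).2), hzI, rfl, (cl2 t).1, (cl2 t).2, ?_⟩
      refine (hpath.tail (c := cl t) ⟨hz', htcI, ?_⟩).tail ⟨htcI, hzI, Or.inl ⟨h.le, le_rfl⟩⟩
      rcases le_total z'.2 (cl t).2 with h' | h'
      · exact Or.inl ⟨e'.le, h'⟩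
      · exact Or.inr ⟨⟨e'.ge, h'⟩, Prod.ext (congrArg ρ₁ e')
          (hρ _ _ hb hb' (cl2 t).1 (cl2 t).2)⟩
  refine (main q (hI.connected p hp q hq)).2 c hc ?_
  simpa [cl] using Or.inr hc'

/-- The mirror image of `exists_fiberPath` under exchange of the coordinates. -/
theorem IsPosetInterval.exists_fiberPath' {I : Set (α × β)} (hI : IsPosetInterval I)
    (ρ₁ : α →o A) (ρ₂ : β →o B) {p q : α × β} (hp : p ∈ I) (hq : q ∈ I) (h2 : p.2 ≤ q.2)
    (h1 : q.1 ≤ p.1) (e : ρ₁ p.1 = ρ₁ q.1) {c : β} (hc : p.2 ≤ c) (hc' : c ≤ q.2) :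
    ∃ z ∈ I, z.2 = c ∧ q.1 ≤ z.1 ∧ z.1 ≤ p.1 ∧
      Relation.ReflTransGen (FiberStep (ρ₁.prodMap ρ₂) I) p z := by
  obtain ⟨z, hz, h, h', h'', hpath⟩ := hI.preimage_swap.exists_fiberPath ρ₂ ρ₁
    (p := p.swap) (q := q.swap) (by simpa using hp) (by simpa using hq) h2 h1 e hc hc'
  refine ⟨z.swap, hz, h, h', h'', ?_⟩
  have := hpath.lift Prod.swap (p := FiberStep (ρ₁.prodMap ρ₂) I) (by
    rintro a b ⟨ha, hb, h⟩
    refine ⟨ha, hb, ?_⟩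
    rcases h with h | ⟨h, he⟩
    · exact Or.inl (Prod.swap_le_swap.mpr h)
    · refine Or.inr ⟨Prod.swap_le_swap.mpr h, ?_⟩
      have he' := Prod.ext_iff.mp he
      exact Prod.ext he'.2 he'.1)
  exact this

/-- Clamping `x` to `[a, b]` does not change its image, by monotonicity. -/
theorem exists_between_of_le (σ : α →o A) {a b x : α} (hab : a ≤ b) (hax : σ a ≤ σ x)
    (hxb : σ x ≤ σ b) : ∃ c, a ≤ c ∧ c ≤ b ∧ σ c = σ x := by
  rcases le_total x a with h | h
  · exact ⟨a, le_rfl, hab, le_antisymm hax (σ.monotone h)⟩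
  rcases le_total b x with h' | h'
  · exact ⟨b, hab, le_rfl, le_antisymm (σ.monotone h') hxb⟩
  · exact ⟨x, h, h', rfl⟩

/-- The properties of a monotone map which make the intervals of its source and the intervals
saturated for its fibres interchangeable. -/
structure IsIntervalSaturated {P Q : Type*} [PartialOrder P] [PartialOrder Q] (ρ : P →o Q) :
    Prop where
  path : ∀ {I : Set P}, IsPosetInterval I → ∀ {p q : P}, p ∈ I → q ∈ I → ρ p ≤ ρ q →
    Relation.ReflTransGen (FiberStep ρ I) p q
  between : ∀ {I : Set P}, IsPosetInterval I → ∀ {p q r : P}, p ∈ I → q ∈ I → ρ p ≤ ρ r →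
    ρ r ≤ ρ q → ∃ t ∈ I, ρ t = ρ r
  join : ∀ {p q : P}, ρ p = ρ q → ∃ r, p ≤ r ∧ q ≤ r ∧ ρ r = ρ p

/-- If `p` and `q` are not ordered compatibly in some coordinate, then `ρ p ≤ ρ q` forces equality
of the images in that coordinate. When exactly one coordinate is reversed, the strip argument of
`exists_fiberPath` connects the points. For `join`, the supremum of two points takes each coordinate
from one of them, hence stays in the fibre. -/
theorem isIntervalSaturated_prodMap (ρ₁ : α →o A) (ρ₂ : β →o B) :
    IsIntervalSaturated (ρ₁.prodMap ρ₂) where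
  path := by
    intro I hI p q hp hq hle
    by_cases hpq : p ≤ q
    · exact .single ⟨hp, hq, Or.inl hpq⟩
    rcases le_total p.1 q.1 with h1 | h1
    · have h2 : q.2 ≤ p.2 := (le_total q.2 p.2).resolve_right fun h => hpq ⟨h1, h⟩
      have e : ρ₂ p.2 = ρ₂ q.2 := le_antisymm hle.2 (ρ₂.monotone h2)
      obtain ⟨z, hz, hz1, hz2, hz3, hpath⟩ := hI.exists_fiberPath ρ₁ ρ₂ hp hq h1 h2 e h1 le_rfl
      refine hpath.tail ⟨hz, hq, Or.inr ⟨⟨hz1.ge, hz2⟩, Prod.ext (congrArg ρ₁ hz1) ?_⟩⟩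
      exact le_antisymm ((ρ₂.monotone hz3).trans e.le) (ρ₂.monotone hz2)
    · have e : ρ₁ p.1 = ρ₁ q.1 := le_antisymm hle.1 (ρ₁.monotone h1)
      rcases le_total p.2 q.2 with h2 | h2
      · obtain ⟨z, hz, hz1, hz2, hz3, hpath⟩ :=
          hI.exists_fiberPath' ρ₁ ρ₂ hp hq h2 h1 e h2 le_rfl
        refine hpath.tail ⟨hz, hq, Or.inr ⟨⟨hz2, hz1.ge⟩, Prod.ext ?_ (congrArg ρ₂ hz1)⟩⟩
        exact le_antisymm ((ρ₁.monotone hz3).trans e.le) (ρ₁.monotone hz2)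
      · exact .single ⟨hp, hq, Or.inr ⟨⟨h1, h2⟩,
          Prod.ext e (le_antisymm hle.2 (ρ₂.monotone h2))⟩⟩
  between := by
    intro I hI p q r hp hq hpr hrq
    rcases le_total p.1 q.1 with h1 | h1
    · obtain ⟨c, hc, hc', hce⟩ := exists_between_of_le ρ₁ h1 hpr.1 hrq.1
      rcases le_total p.2 q.2 with h2 | h2
      · obtain ⟨d, hd, hd', hde⟩ := exists_between_of_le ρ₂ h2 hpr.2 hrq.2
        exact ⟨(c, d), hI.convex p hp q hq _ ⟨hc, hd⟩ ⟨hc', hd'⟩, Prod.ext hce hde⟩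
      · have e : ρ₂ p.2 = ρ₂ q.2 := le_antisymm (hpr.2.trans hrq.2) (ρ₂.monotone h2)
        obtain ⟨z, hz, hz1, hz2, hz3, -⟩ := hI.exists_fiberPath ρ₁ ρ₂ hp hq h1 h2 e hc hc'
        refine ⟨z, hz, Prod.ext ((congrArg ρ₁ hz1).trans hce) ?_⟩
        exact le_antisymm ((ρ₂.monotone hz3).trans hpr.2) (hrq.2.trans (ρ₂.monotone hz2))
    · have e : ρ₁ p.1 = ρ₁ q.1 := le_antisymm (hpr.1.trans hrq.1) (ρ₁.monotone h1)
      rcases le_total p.2 q.2 with h2 | h2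
      · obtain ⟨d, hd, hd', hde⟩ := exists_between_of_le ρ₂ h2 hpr.2 hrq.2
        obtain ⟨z, hz, hz1, hz2, hz3, -⟩ := hI.exists_fiberPath' ρ₁ ρ₂ hp hq h2 h1 e hd hd'
        refine ⟨z, hz, Prod.ext ?_ ((congrArg ρ₂ hz1).trans hde)⟩
        exact le_antisymm ((ρ₁.monotone hz3).trans hpr.1) (hrq.1.trans (ρ₁.monotone hz2))
      · exact ⟨p, hp, Prod.ext (le_antisymm hpr.1 (hrq.1.trans_eq e.symm))
          (le_antisymm hpr.2 (hrq.2.trans (ρ₂.monotone h2)))⟩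
  join := by
    rintro p q h
    have h' := Prod.ext_iff.mp h
    refine ⟨p ⊔ q, le_sup_left, le_sup_right, Prod.ext ?_ ?_⟩
    · change ρ₁ (p.1 ⊔ q.1) = ρ₁ p.1
      rcases le_total p.1 q.1 with h1 | h1
      · rw [sup_eq_right.mpr h1]; exact h'.1.symm
      · rw [sup_eq_left.mpr h1]
    · change ρ₂ (p.2 ⊔ q.2) = ρ₂ p.2
      rcases le_total p.2 q.2 with h1 | h1
      · rw [sup_eq_right.mpr h1]; exact h'.2.symm
      · rw [sup_eq_left.mpr h1]

end FiberPaths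

/-! ### Saturated intervals and existence of diagrams for pullbacks -/

section Saturation

variable {P Q : Type*} [PartialOrder P] [PartialOrder Q] {ρ : P →o Q}

/-- The saturation of an interval with respect to the fibres of `ρ` is an interval. -/
theorem IsIntervalSaturated.isPosetInterval_saturation (hρ : IsIntervalSaturated ρ) {I : Set P}
    (hI : IsPosetInterval I) : IsPosetInterval (ρ ⁻¹' (ρ '' I)) where
  nonempty := hI.nonempty.mono (Set.subset_preimage_image ρ I)
  convex := by
    rintro x ⟨p, hp, hpx⟩ y ⟨q, hq, hqy⟩ r hxr hry
    exact hρ.between hI hp hq (hpx ▸ ρ.monotone hxr) (hqy ▸ ρ.monotone hry)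
  connected := by
    -- A point of the saturation is linked to a point of `I` through a common upper bound inside
    -- their fibre.
    have key : ∀ x p, p ∈ I → ρ p = ρ x →
        Relation.ReflTransGen (fun a b => b ∈ ρ ⁻¹' (ρ '' I) ∧ (a ≤ b ∨ b ≤ a)) x p ∧
        Relation.ReflTransGen (fun a b => b ∈ ρ ⁻¹' (ρ '' I) ∧ (a ≤ b ∨ b ≤ a)) p x := by
      intro x p hp e
      obtain ⟨r, h1, h2, h3⟩ := hρ.join e
      have hr : r ∈ ρ ⁻¹' (ρ '' I) := ⟨p, hp, h3.symm⟩
      have hx : x ∈ ρ ⁻¹' (ρ '' I) := ⟨p, hp, e⟩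
      have hp' : p ∈ ρ ⁻¹' (ρ '' I) := ⟨p, hp, rfl⟩
      exact ⟨(Relation.ReflTransGen.single ⟨hr, Or.inl h2⟩).tail ⟨hp', Or.inr h1⟩,
        (Relation.ReflTransGen.single ⟨hr, Or.inl h1⟩).tail ⟨hx, Or.inr h2⟩⟩
    rintro x ⟨p, hp, hpx⟩ y ⟨q, hq, hqy⟩
    refine ((key x p hp hpx).1.trans ?_).trans (key y q hq hqy).2
    exact (hI.connected p hp q hq).lift id fun a b h => ⟨⟨b, h.1, rfl⟩, h.2⟩

universe w

variable {F : Type*} [Field F] (N : PersistenceModule.{w} F Q)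

theorem PersistenceModule.map_map (M : PersistenceModule.{w} F P) {p q r : P} (h : p ≤ q)
    (h' : q ≤ r) (x : M.obj p) : M.map h' (M.map h x) = M.map (h.trans h') x :=
  (M.map_comp h h' x).symm

/-- The value of a section of a pullback. -/
def pmSectionValue {I : Set P} (s : pmLimit (N.restrict ρ) I) (p : I) : N.obj (ρ p) := s.1 p

/-- The inclusion of a value of a pullback into its colimit. -/
noncomputable def pmPullbackIncl (ρ : P →o Q) (I : Set P) (p : I) :
    N.obj (ρ p) →ₗ[F] PmColimit (N.restrict ρ) I :=
  pmColimitIncl (N.restrict ρ) I p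

theorem map_pmSectionValue {I : Set P} (s : pmLimit (N.restrict ρ) I) {p q : I} (h : p.1 ≤ q.1) :
    N.map (ρ.monotone h) (pmSectionValue N s p) = pmSectionValue N s q :=
  s.2 p q h

theorem pmPullbackIncl_map {I : Set P} {p q : I} (h : p.1 ≤ q.1) (v : N.obj (ρ p)) :
    pmPullbackIncl N ρ I q (N.map (ρ.monotone h) v) = pmPullbackIncl N ρ I p v :=
  pmColimitIncl_map (N.restrict ρ) I h v

/-- Fibre paths need not be monotone, but their images under `ρ` are: a downward step stays over one
point of `Q`, where the structure map is invertible and can be undone. -/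
theorem map_pmSectionValue_of_fiberPath {I : Set P} (s : pmLimit (N.restrict ρ) I) (p : I) {q : P}
    (h : Relation.ReflTransGen (FiberStep ρ I) p q) :
    ∃ (hq : q ∈ I) (hle : ρ p ≤ ρ q),
      N.map hle (pmSectionValue N s p) = pmSectionValue N s ⟨q, hq⟩ := by
  induction h with
  | refl => exact ⟨p.2, le_rfl, N.map_id _ _⟩
  | @tail a b _ hab ih =>
    obtain ⟨ha, hpa, e⟩ := ih
    obtain ⟨-, hb, h | ⟨h, he⟩⟩ := hab
    · refine ⟨hb, hpa.trans (ρ.monotone h), ?_⟩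
      rw [← map_pmSectionValue N s (p := ⟨a, ha⟩) (q := ⟨b, hb⟩) h, ← e, N.map_map]
    · refine ⟨hb, hpa.trans he.le, ?_⟩
      rw [← N.map_map hpa he.le, e, ← map_pmSectionValue N s (p := ⟨b, hb⟩) (q := ⟨a, ha⟩) h,
        N.map_map, N.map_id]

/-- The dual statement, with the colimit in place of sections. -/
theorem pmPullbackIncl_map_of_fiberPath {I : Set P} (p : I) {q : P}
    (h : Relation.ReflTransGen (FiberStep ρ I) p q) :
    ∃ (hq : q ∈ I) (hle : ρ p ≤ ρ q), ∀ v : N.obj (ρ p),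
      pmPullbackIncl N ρ I ⟨q, hq⟩ (N.map hle v) = pmPullbackIncl N ρ I p v := by
  induction h with
  | refl => exact ⟨p.2, le_rfl, fun v => by rw [N.map_id]⟩
  | @tail a b _ hab ih =>
    obtain ⟨ha, hpa, e⟩ := ih
    obtain ⟨-, hb, h | ⟨h, he⟩⟩ := hab
    · refine ⟨hb, hpa.trans (ρ.monotone h), fun v => ?_⟩
      rw [← e v, ← pmPullbackIncl_map N (p := ⟨a, ha⟩) (q := ⟨b, hb⟩) h, N.map_map]
    · refine ⟨hb, hpa.trans he.le, fun v => ?_⟩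
      rw [← e v, ← pmPullbackIncl_map N (p := ⟨b, hb⟩) (q := ⟨a, ha⟩) h, N.map_map]

/-- A section over an interval extends to the saturation of the interval. -/
theorem IsIntervalSaturated.exists_extension (hρ : IsIntervalSaturated ρ) {I : Set P}
    (hI : IsPosetInterval I) (s : pmLimit (N.restrict ρ) I) :
    ∃ t : pmLimit (N.restrict ρ) (ρ ⁻¹' (ρ '' I)), ∀ p : I,
      pmSectionValue N t ⟨p, Set.subset_preimage_image ρ I p.2⟩ = pmSectionValue N s p := by
  choose r hr hre using fun x : (ρ ⁻¹' (ρ '' I) : Set P) => x.2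
  have key : ∀ (p q : I) (h : ρ p ≤ ρ q),
      N.map h (pmSectionValue N s p) = pmSectionValue N s q := by
    intro p q h
    obtain ⟨_, _, e⟩ := map_pmSectionValue_of_fiberPath N s p (hρ.path hI p.2 q.2 h)
    exact e
  -- The value at `x` is copied from a chosen point of `I` in the same fibre; `key` makes the choice
  -- irrelevant.
  let val : ∀ x : (ρ ⁻¹' (ρ '' I) : Set P), N.obj (ρ x) := fun x =>
    N.map (hre x).le (pmSectionValue N s ⟨r x, hr x⟩)
  have hval : ∀ (x y : (ρ ⁻¹' (ρ '' I) : Set P)) (h : x.1 ≤ y.1),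
      N.map (ρ.monotone h) (val x) = val y := by
    intro x y h
    have h' : ρ (r x) ≤ ρ (r y) := by rw [hre x, hre y]; exact ρ.monotone h
    simp only [val]
    rw [← key ⟨r x, hr x⟩ ⟨r y, hr y⟩ h', N.map_map, N.map_map]
  refine ⟨⟨val, hval⟩, fun p => ?_⟩
  exact key ⟨r _, hr _⟩ p (hre _).le

/-- The colimit over an interval embeds into the colimit over its saturation. -/
theorem IsIntervalSaturated.exists_colimit_embedding (hρ : IsIntervalSaturated ρ) {I : Set P}
    (hI : IsPosetInterval I) :
    ∃ i : PmColimit (N.restrict ρ) I →ₗ[F] PmColimit (N.restrict ρ) (ρ ⁻¹' (ρ '' I)),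
      Function.Injective i ∧ ∀ (p : I) (v : N.obj (ρ p)), i (pmPullbackIncl N ρ I p v) =
        pmPullbackIncl N ρ _ ⟨p, Set.subset_preimage_image ρ I p.2⟩ v := by
  classical
  choose r hr hre using fun x : (ρ ⁻¹' (ρ '' I) : Set P) => x.2
  have key : ∀ (p q : I) (h : ρ p ≤ ρ q) (v : N.obj (ρ p)),
      pmPullbackIncl N ρ I q (N.map h v) = pmPullbackIncl N ρ I p v := by
    intro p q h v
    obtain ⟨_, _, e⟩ := pmPullbackIncl_map_of_fiberPath N p (hρ.path hI p.2 q.2 h)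
    exact e v
  have aux : ∀ (x y : (ρ ⁻¹' (ρ '' I) : Set P)) (h : x.1 ≤ y.1) (v : N.obj (ρ x)),
      pmPullbackIncl N ρ I ⟨r y, hr y⟩ (N.map (hre y).ge (N.map (ρ.monotone h) v)) =
        pmPullbackIncl N ρ I ⟨r x, hr x⟩ (N.map (hre x).ge v) := by
    intro x y h v
    have h' : ρ (r x) ≤ ρ (r y) := by rw [hre x, hre y]; exact ρ.monotone h
    rw [← key ⟨r x, hr x⟩ ⟨r y, hr y⟩ h', N.map_map, N.map_map]
  let i : PmColimit (N.restrict ρ) I →ₗ[F] PmColimit (N.restrict ρ) (ρ ⁻¹' (ρ '' I)) :=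
    Module.DirectLimit.lift F I _ _
      (fun p : I => pmPullbackIncl N ρ _ ⟨p, Set.subset_preimage_image ρ I p.2⟩)
      (fun p q h v => pmPullbackIncl_map (I := ρ ⁻¹' (ρ '' I)) N
        (p := ⟨p, Set.subset_preimage_image ρ I p.2⟩)
        (q := ⟨q, Set.subset_preimage_image ρ I q.2⟩) h (show N.obj (ρ p) from v))
  -- A retraction of `i`: each point of the saturation is replaced by its chosen representative in
  -- `I`.
  let j : PmColimit (N.restrict ρ) (ρ ⁻¹' (ρ '' I)) →ₗ[F] PmColimit (N.restrict ρ) I :=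
    Module.DirectLimit.lift F _ _ _
      (fun x : (ρ ⁻¹' (ρ '' I) : Set P) =>
        (pmPullbackIncl N ρ I ⟨r x, hr x⟩).comp (N.map (hre x).ge))
      (fun x y h v => aux x y h v)
  have hi : ∀ (p : I) (v : N.obj (ρ p)), i (pmPullbackIncl N ρ I p v) =
      pmPullbackIncl N ρ _ ⟨p, Set.subset_preimage_image ρ I p.2⟩ v := fun p v =>
    Module.DirectLimit.lift_of _ _ _
  have hj : ∀ (x : (ρ ⁻¹' (ρ '' I) : Set P)) (v : N.obj (ρ x)),
      j (pmPullbackIncl N ρ _ x v) = pmPullbackIncl N ρ I ⟨r x, hr x⟩ (N.map (hre x).ge v) :=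
    fun x v => Module.DirectLimit.lift_of _ _ _
  have hji' : ∀ (p : I) (v : N.obj (ρ p)), j (i (pmPullbackIncl N ρ I p v)) =
      pmPullbackIncl N ρ I p v := by
    intro p v
    rw [hi, hj]
    exact key p ⟨_, hr _⟩ (hre ⟨p.1, Set.subset_preimage_image ρ I p.2⟩).ge v
  have hji : j.comp i = LinearMap.id := by
    refine Module.DirectLimit.hom_ext fun p => LinearMap.ext fun v => ?_
    exact hji' p v
  exact ⟨i, Function.LeftInverse.injective (g := j) fun x => LinearMap.congr_fun hji x, hi⟩

theorem genRank_eq_finrank {P : Type*} [PartialOrder P] (M : PersistenceModule.{w} F P)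
    (I : PosetInt P) (p : I.1) :
    genRank M I = Module.finrank F (LinearMap.range (pmLimToColim M I.1 p)) := by
  rw [genRank, pmLimToColim_eq M I _ p]

/-- The saturation of an interval, as an interval. -/
def IsIntervalSaturated.saturation (hρ : IsIntervalSaturated ρ) (I : PosetInt P) : PosetInt P :=
  ⟨ρ ⁻¹' (ρ '' I.1), hρ.isPosetInterval_saturation I.2⟩

/-- The generalized rank of a pullback only depends on the saturation of the interval. -/
theorem IsIntervalSaturated.genRank_saturation (hρ : IsIntervalSaturated ρ) (I : PosetInt P) :
    genRank (N.restrict ρ) (hρ.saturation I) = genRank (N.restrict ρ) I := by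
  obtain ⟨p, hp⟩ := I.2.nonempty
  obtain ⟨i, hi, hi'⟩ := hρ.exists_colimit_embedding N I.2
  rw [genRank_eq_finrank _ I ⟨p, hp⟩,
    genRank_eq_finrank _ (hρ.saturation I) ⟨p, Set.subset_preimage_image ρ I.1 hp⟩]
  -- Sections restrict to `I` and, conversely, extend from it, so the two images correspond under
  -- the embedding `i`.
  have hr : LinearMap.range (pmLimToColim (N.restrict ρ) (hρ.saturation I).1
        ⟨p, Set.subset_preimage_image ρ I.1 hp⟩) =
      (LinearMap.range (pmLimToColim (N.restrict ρ) I.1 ⟨p, hp⟩)).map i := by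
    apply le_antisymm
    · rintro _ ⟨t, rfl⟩
      let s : pmLimit (N.restrict ρ) I.1 :=
        ⟨fun q => t.1 ⟨q.1, Set.subset_preimage_image ρ I.1 q.2⟩, fun q q' h =>
          t.2 ⟨q.1, Set.subset_preimage_image ρ I.1 q.2⟩
            ⟨q'.1, Set.subset_preimage_image ρ I.1 q'.2⟩ h⟩
      exact ⟨_, ⟨s, rfl⟩, hi' ⟨p, hp⟩ (pmSectionValue N s ⟨p, hp⟩)⟩
    · rintro _ ⟨_, ⟨s, rfl⟩, rfl⟩
      obtain ⟨t, ht⟩ := hρ.exists_extension N I.2 s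
      refine ⟨t, ?_⟩
      refine Eq.trans ?_ (hi' ⟨p, hp⟩ (pmSectionValue N s ⟨p, hp⟩)).symm
      rw [← ht ⟨p, hp⟩]
      rfl
  rw [hr]
  exact (Submodule.equivMapOfInjective i hi _).finrank_eq.symm

/-- Möbius inversion over a finite subset of a partial order. -/
theorem exists_sum_over_ge_eq {T : Type*} [PartialOrder T] (s : Finset T) (r : T → ℤ) :
    ∃ f : T → ℤ, Function.support f ⊆ s ∧
      ∀ J ∈ s, r J = ∑ᶠ (J' : T) (_ : J ≤ J'), f J' := by
  classical
  induction s using Finset.strongInduction with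
  | H s ih =>
  rcases s.eq_empty_or_nonempty with rfl | hs
  · exact ⟨0, by simp, by simp⟩
  -- A minimal element enters no upward sum based at another element of `s`, so the value there can
  -- be adjusted last without disturbing the equations already solved.
  obtain ⟨m, hm⟩ := s.exists_minimal hs
  obtain ⟨f, hf, hf'⟩ := ih (s.erase m) (Finset.erase_ssubset hm.prop)
  have hfin : ∀ g : T → ℤ, Function.support g ⊆ s → ∀ J, ∑ᶠ (J' : T) (_ : J ≤ J'), g J' =
      ∑ J' ∈ s with J ≤ J', g J' := by
    intro g hg J
    have := finsum_mem_eq_sum_of_inter_support_eq (s := {J' | J ≤ J'})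
      (t := s.filter (J ≤ ·)) g (by
        ext x
        simp only [Set.mem_inter_iff, Set.mem_ofPred_eq, Finset.coe_filter]
        constructor
        · rintro ⟨h, h'⟩; exact ⟨⟨hg h', h⟩, h'⟩
        · rintro ⟨h, h'⟩; exact ⟨h.2, h'⟩)
    exact this
  have hfs : Function.support f ⊆ s := hf.trans (by simp)
  have hfm : f m = 0 := by
    by_contra h
    simpa using hf h
  have hup : Function.support (Function.update f m (r m - ∑ J' ∈ s with m ≤ J', f J')) ⊆ s := by
    intro x hx
    by_cases hxm : x = m
    · exact hxm ▸ hm.prop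
    · rw [Function.mem_support, Function.update_of_ne hxm] at hx
      exact hfs hx
  refine ⟨_, hup, fun J hJ => ?_⟩
  rw [hfin _ hup]
  by_cases hJm : J = m
  · subst hJm
    have hmem : J ∈ s.filter (J ≤ ·) := by simp [hJ]
    rw [Finset.sum_update_of_mem hmem, ← Finset.erase_eq, ← Finset.add_sum_erase _ f hmem, hfm]
    ring
  · rw [hf' J (Finset.mem_erase.mpr ⟨hJm, hJ⟩), hfin f hfs]
    refine Finset.sum_congr rfl fun x hx => ?_
    rw [Function.update_of_ne]
    rintro rfl
    exact hJm (hm.eq_of_le hJ (Finset.mem_filter.mp hx).2)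

/-- A pullback along a map with finite range has a generalized persistence diagram with finite
support. -/
theorem IsIntervalSaturated.exists_isGPD (hρ : IsIntervalSaturated ρ) (hfin : (Set.range ρ).Finite) :
    ∃ f, IsGPD (N.restrict ρ) f ∧ (Function.support f).Finite := by
  have hsat : (Set.range hρ.saturation).Finite := by
    -- Every saturation is the preimage of a subset of the finite range of `ρ`.
    refine Set.Finite.of_finite_image (f := fun J : PosetInt P => J.1) ?_
      Subtype.val_injective.injOn
    refine (hfin.finite_subsets.image (fun A => ρ ⁻¹' A)).subset ?_
    rintro _ ⟨_, ⟨I, rfl⟩, rfl⟩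
    exact ⟨ρ '' I.1, Set.image_subset_range _ _, rfl⟩
  obtain ⟨f, hf, hf'⟩ :=
    exists_sum_over_ge_eq hsat.toFinset (fun I => (genRank (N.restrict ρ) I : ℤ))
  have hsupp : (Function.support f).Finite := hsat.toFinset.finite_toSet.subset hf
  refine ⟨f, fun I => ⟨hsupp.subset fun J hJ => hJ.2, ?_⟩, hsupp⟩
  rw [← hρ.genRank_saturation N I, hf' (hρ.saturation I) (by simp)]
  refine finsum_congr fun J => ?_
  by_cases hJ : f J = 0
  · simp [hJ]
  have hJs : J ∈ Set.range hρ.saturation := by simpa using hf hJ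
  obtain ⟨K, rfl⟩ := hJs
  -- A saturated set contains `I` as soon as it contains the saturation of `I`, and conversely; so
  -- the sum over saturated intervals is the sum required for `I`.
  have : hρ.saturation I ≤ hρ.saturation K ↔ I.1 ⊆ (hρ.saturation K).1 := by
    refine ⟨fun h => (Set.subset_preimage_image ρ I.1).trans h, ?_⟩
    rintro h x ⟨p, hp, e⟩
    obtain ⟨q, hq, e'⟩ := h hp
    exact ⟨q, hq, e'.trans e⟩
  exact finsum_congr_Prop (propext this) fun _ => rfl

end Saturation

/-! ### The size of the diagram of a module with zigzag structure -/

section ZigzagSize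

universe w

/-- A function whose sums over the powersets of nonempty sets are `1`, and which vanishes at the
empty set, is alternating away from the empty set. -/
theorem eq_of_sum_powerset_eq_ite {ι : Type*} [DecidableEq ι] (H : Finset ι → ℤ)
    (h : ∀ U : Finset ι, ∑ U' ∈ U.powerset, H U' = if U = ∅ then 0 else 1) (U : Finset ι) :
    H U = (if U = ∅ then 1 else 0) - (-1) ^ U.card := by
  induction U using Finset.strongInduction with
  | H U ih =>
  -- The asserted formula has the same powerset sums, because alternating sums over powersets of
  -- nonempty sets vanish; the sums determine the function inductively.
  have key : ∑ U' ∈ U.powerset, ((if U' = ∅ then 1 else 0) - (-1 : ℤ) ^ U'.card) =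
      if U = ∅ then 0 else 1 := by
    rw [Finset.sum_sub_distrib, Finset.sum_powerset_neg_one_pow_card]
    simp
    split_ifs <;> simp
  have hU : U ∈ U.powerset := Finset.mem_powerset_self U
  rw [← h, ← Finset.add_sum_erase _ _ hU, ← Finset.add_sum_erase _ H hU] at key
  have : ∑ U' ∈ U.powerset.erase U, H U' =
      ∑ U' ∈ U.powerset.erase U, ((if U' = ∅ then 1 else 0) - (-1 : ℤ) ^ U'.card) := by
    refine Finset.sum_congr rfl fun U' hU' => ih U' ?_
    rw [Finset.mem_erase, Finset.mem_powerset] at hU'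
    exact Finset.ssubset_iff_subset_ne.mpr ⟨hU'.2, hU'.1⟩
  rw [this] at key
  exact (add_right_cancel key).symm

variable {F : Type*} [Field F] {P : Type*} [PartialOrder P] (M : PersistenceModule.{w} F P)

/-- The set of points below `w` and above a point of `G`. -/
def cappedUpperSet (w : P) (G : Set P) : Set P := {p | p ≤ w ∧ ∃ a ∈ G, a ≤ p}

theorem isPosetInterval_cappedUpperSet {w : P} {G : Set P} (hG : ∃ a ∈ G, a ≤ w) :
    IsPosetInterval (cappedUpperSet w G) where
  nonempty := ⟨w, le_rfl, hG⟩
  convex := by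
    rintro p ⟨-, a, ha, hap⟩ q ⟨hq, -⟩ r hpr hrq
    exact ⟨hrq.trans hq, a, ha, hap.trans hpr⟩
  connected := by
    rintro p hp q hq
    exact (Relation.ReflTransGen.single ⟨⟨le_rfl, hG⟩, Or.inl hp.1⟩).tail ⟨hq, Or.inr hq.1⟩

/-- Every point of the set lies between a generator and `w`, so convexity of `J` reduces containment
to these points. -/
theorem cappedUpperSet_subset_iff {w : P} {G : Set P} (hG : ∃ a ∈ G, a ≤ w) (hGw : ∀ a ∈ G, a ≤ w)
    {J : Set P} (hJ : IsPosetInterval J) : cappedUpperSet w G ⊆ J ↔ w ∈ J ∧ G ⊆ J := by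
  constructor
  · exact fun h => ⟨h ⟨le_rfl, hG⟩, fun a ha => h ⟨hGw a ha, a, ha, le_rfl⟩⟩
  · rintro ⟨h1, h2⟩ p ⟨hp, a, ha, hap⟩
    exact hJ.convex a (h2 ha) w h1 p hap hp

/-- The inclusion of the value at the greatest element into the colimit is injective. -/
theorem pmColimitIncl_injective_of_top {I : Set P} (w : I) (hw : ∀ p ∈ I, p ≤ w.1) :
    Function.Injective (pmColimitIncl M I w) := by
  classical
  let j : PmColimit M I →ₗ[F] M.obj w.1 :=
    Module.DirectLimit.lift F I _ _ (fun p : I => M.map (hw p.1 p.2))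
      (fun p q h v => M.map_map (show p.1 ≤ q.1 from h) (hw q.1 q.2) v)
  refine Function.LeftInverse.injective (g := j) fun v => ?_
  exact (Module.DirectLimit.lift_of _ _ _).trans (M.map_id _ _)

/-- A greatest element makes the colimit trivial: the rank only measures which values at `w` extend
to sections. -/
theorem genRank_eq_finrank_range_proj {I : PosetInt P} (w : I.1) (hw : ∀ p ∈ I.1, p ≤ w.1) :
    genRank M I = Module.finrank F (LinearMap.range (pmLimitProj M I.1 w)) := by
  rw [genRank_eq_finrank M I w, pmLimToColim, LinearMap.range_comp]
  exact (Submodule.equivMapOfInjective _ (pmColimitIncl_injective_of_top M w hw) _).finrank_eq.symm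

/-- The point of the grid below the last row at which the zigzag module is `F ^ (n + 1)`. -/
def zigzagApex (n : ℕ) : Fin (n + 2) × Fin (n + 2) := (Fin.last _, (Fin.last n).castSucc)

/-- The points of the grid at which the zigzag module is a hyperplane. -/
def zigzagDiag (n : ℕ) (k : Fin (n + 1)) : Fin (n + 2) × Fin (n + 2) := (k.castSucc, k.rev.castSucc)

/-- The points generating the interval in which the hyperplanes with index in `U` are missing. -/
def zigzagGenerators (n : ℕ) (U : Finset (Fin (n + 1))) : Set (Fin (n + 2) × Fin (n + 2)) :=
  {a | a = zigzagApex n ∨ ∃ k ∉ U, a = zigzagDiag n k}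

theorem zigzagGenerators_le_apex {n : ℕ} {U : Finset (Fin (n + 1))} {a}
    (ha : a ∈ zigzagGenerators n U) : a ≤ zigzagApex n := by
  obtain rfl | ⟨k, -, rfl⟩ := ha
  · exact le_rfl
  · exact ⟨Fin.le_last _, Fin.castSucc_le_castSucc_iff.mpr (Fin.le_last _)⟩

variable {M} {n : ℕ} {g : Fin (n + 2) × Fin (n + 2) →o P}

/-- The interval spanned by the generators. -/
def zigzagInterval (g : Fin (n + 2) × Fin (n + 2) →o P) (U : Finset (Fin (n + 1))) : PosetInt P :=
  ⟨cappedUpperSet (g (Fin.last _, Fin.last _)) (g '' zigzagGenerators n U),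
    isPosetInterval_cappedUpperSet
      ⟨_, ⟨zigzagApex n, Or.inl rfl, rfl⟩, g.monotone ⟨le_rfl, Fin.le_last _⟩⟩⟩

/-- Consequently the contribution of `J` depends only on two fixed points and on whether the set of
missed diagonal indices is contained in `U`, which is what makes inversion over subsets possible. -/
theorem zigzagInterval_subset_iff (U : Finset (Fin (n + 1))) (J : PosetInt P) :
    (zigzagInterval g U).1 ⊆ J.1 ↔ (g (Fin.last _, Fin.last _) ∈ J.1 ∧ g (zigzagApex n) ∈ J.1) ∧
      ∀ k ∉ U, g (zigzagDiag n k) ∈ J.1 := by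
  have hcap := cappedUpperSet_subset_iff (w := g (Fin.last _, Fin.last _))
    (G := g '' zigzagGenerators n U) ⟨_, ⟨zigzagApex n, Or.inl rfl, rfl⟩,
    g.monotone ⟨le_rfl, Fin.le_last _⟩⟩ ?_ J.2
  · refine hcap.trans ?_
    rw [and_assoc]
    refine and_congr_right fun _ => ?_
    constructor
    · exact fun h => ⟨h ⟨_, Or.inl rfl, rfl⟩, fun k hk => h ⟨_, Or.inr ⟨k, hk, rfl⟩, rfl⟩⟩
    · rintro ⟨h1, h2⟩ _ ⟨a, rfl | ⟨k, hk, rfl⟩, rfl⟩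
      exacts [h1, h2 k hk]
  · rintro _ ⟨a, ha, rfl⟩
    exact g.monotone ((zigzagGenerators_le_apex ha).trans ⟨le_rfl, Fin.le_last _⟩)

/-- A section has an apex value that vanishes in every coordinate outside `U`, and its value at the
top is the coordinate sum. For `U = ∅` this is zero. Otherwise a basis vector with index in `U`
extends to a section with sum `1`, and the top value is one-dimensional. -/
theorem genRank_zigzagInterval
    (hg : ∀ a b p, g a ≤ p → g b ≤ p → g (a ⊔ b) ≤ p) (hz : HasZigzagStructure n (M.restrict g))
    (U : Finset (Fin (n + 1))) : genRank M (zigzagInterval g U) = if U = ∅ then 0 else 1 := by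
  have hz' : ∃ (φ : ∀ p, M.obj (g p) →ₗ[F] (Fin (n + 1) → F)) (ψ : ∀ p, M.obj (g p) →ₗ[F] F),
    (∀ p : Fin (n + 2) × Fin (n + 2), (p.2 : ℕ) ≤ n →
      Function.Injective (φ p) ∧
      ∀ v : Fin (n + 1) → F, v ∈ LinearMap.range (φ p) ↔
        ((p.1 : ℕ) + p.2 < n → v = 0) ∧
        ((p.1 : ℕ) + p.2 = n → ∀ k : Fin (n + 1), (k : ℕ) = p.1 → v k = 0)) ∧
    (∀ p : Fin (n + 2) × Fin (n + 2), (p.2 : ℕ) = n + 1 → Function.Bijective (ψ p)) ∧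
    (∀ (p q : Fin (n + 2) × Fin (n + 2)) (h : p ≤ q), (q.2 : ℕ) ≤ n →
      ∀ x, φ q (M.map (g.monotone h) x) = φ p x) ∧
    (∀ (p q : Fin (n + 2) × Fin (n + 2)) (h : p ≤ q), (p.2 : ℕ) ≤ n → (q.2 : ℕ) = n + 1 →
      ∀ x, ψ q (M.map (g.monotone h) x) = ∑ k, φ p x k) := by
    obtain ⟨φ, ψ, h1, h2, h3, h4, -⟩ := hz
    exact ⟨φ, ψ, h1, h2, h3, h4⟩
  obtain ⟨φ, ψ, hφ, hψ, hφφ, hφψ⟩ := hz'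
  have hrow : ((zigzagApex n).2 : ℕ) ≤ n := by simp [zigzagApex]
  have hrow' : ∀ {a}, a ∈ zigzagGenerators n U → (a.2 : ℕ) ≤ n := fun ha =>
    (Fin.le_def.mp (zigzagGenerators_le_apex ha).2).trans hrow
  set top : Fin (n + 2) × Fin (n + 2) := (Fin.last _, Fin.last _) with htop
  have htrow : (top.2 : ℕ) = n + 1 := by simp [htop]
  have hatop : zigzagApex n ≤ top := ⟨le_rfl, Fin.le_last _⟩
  have hgle : ∀ {a}, a ∈ zigzagGenerators n U → g a ≤ g top := fun ha =>
    g.monotone ((zigzagGenerators_le_apex ha).trans hatop)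
  have hmem : ∀ {a}, a ∈ zigzagGenerators n U → g a ∈ (zigzagInterval g U).1 := fun {a} ha =>
    ⟨hgle ha, g a, ⟨a, ha, rfl⟩, le_rfl⟩
  have hapex : zigzagApex n ∈ zigzagGenerators n U := Or.inl rfl
  have hwmem : g top ∈ (zigzagInterval g U).1 := ⟨le_rfl, _, ⟨_, hapex, rfl⟩, hgle hapex⟩
  rw [genRank_eq_finrank_range_proj M ⟨g top, hwmem⟩ fun p hp => hp.1]
  have hdiag : ∀ k, k ∉ U → zigzagDiag n k ∈ zigzagGenerators n U := fun k hk => Or.inr ⟨k, hk, rfl⟩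
  split_ifs with hU
  · rw [LinearMap.range_eq_bot.mpr, finrank_bot]
    refine LinearMap.ext fun s => ?_
    refine (hψ top htrow).1 ?_
    rw [LinearMap.zero_apply, map_zero]
    have e1 : M.map (g.monotone hatop) (s.1 ⟨_, hmem hapex⟩) = s.1 ⟨_, hwmem⟩ :=
      s.2 ⟨_, hmem hapex⟩ ⟨_, hwmem⟩ _
    have e2 := hφψ _ _ hatop hrow htrow (s.1 ⟨_, hmem hapex⟩)
    rw [e1] at e2
    refine e2.trans (Finset.sum_eq_zero fun k _ => ?_)
    have hk : k ∉ U := by simp [hU]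
    have hle := zigzagGenerators_le_apex (hdiag k hk)
    have e3 : M.map (g.monotone hle) (s.1 ⟨_, hmem (hdiag k hk)⟩) = s.1 ⟨_, hmem hapex⟩ :=
      s.2 ⟨_, hmem (hdiag k hk)⟩ ⟨_, hmem hapex⟩ _
    rw [← e3, hφφ _ _ hle hrow]
    refine (((hφ (zigzagDiag n k) (hrow' (hdiag k hk))).2 _).mp ⟨_, rfl⟩).2 ?_ k ?_
    · simp [zigzagDiag, Fin.val_rev]; omega
    · simp [zigzagDiag]
  · obtain ⟨k₀, hk₀⟩ := Finset.nonempty_iff_ne_empty.mpr hU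
    have hv : ∀ a ∈ zigzagGenerators n U, ∃ u, φ a u = (Pi.single k₀ 1 : Fin (n + 1) → F) := by
      intro a ha
      refine ((hφ a (hrow' ha)).2 _).mpr ⟨fun h => absurd h ?_, fun h k hk => ?_⟩
      · obtain rfl | ⟨k, -, rfl⟩ := ha
        · simp [zigzagApex]
        · simp [zigzagDiag, Fin.val_rev]; omega
      · obtain rfl | ⟨l, hl, rfl⟩ := ha
        · simp [zigzagApex] at h
        · have : k = l := Fin.ext (by simpa [zigzagDiag] using hk)
          subst this
          exact Pi.single_eq_of_ne (fun h' : k = k₀ => hl (h' ▸ hk₀)) _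
    choose! u hu using hv
    -- The section at `p` must not depend on the generator below `p`. Two generators already agree
    -- at their supremum, where `φ` is injective, and `hg` places that supremum below `p`.
    have hwd : ∀ (a b : Fin (n + 2) × Fin (n + 2)) (_ : a ∈ zigzagGenerators n U)
        (_ : b ∈ zigzagGenerators n U) (p : P) (hap : g a ≤ p) (hbp : g b ≤ p),
        M.map hap (u a) = M.map hbp (u b) := by
      intro a b ha hb p hap hbp
      have hab : ((a ⊔ b).2 : ℕ) ≤ n :=
        (Fin.le_def.mp (sup_le (zigzagGenerators_le_apex ha) (zigzagGenerators_le_apex hb)).2).trans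
          hrow
      have e : M.map (g.monotone (le_sup_left : a ≤ a ⊔ b)) (u a) =
          M.map (g.monotone (le_sup_right : b ≤ a ⊔ b)) (u b) := by
        refine (hφ _ hab).1 ?_
        rw [hφφ a _ le_sup_left hab, hφφ b _ le_sup_right hab, hu a ha, hu b hb]
      have hp := hg a b p hap hbp
      rw [← M.map_map (g.monotone (le_sup_left : a ≤ a ⊔ b)) hp, e, M.map_map]
    choose a ha hap using fun p : (zigzagInterval g U).1 => p.2.2
    choose b hb hba using ha
    have hbp : ∀ p : (zigzagInterval g U).1, g (b p) ≤ p := fun p => (hba p).le.trans (hap p)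
    let s : pmLimit M (zigzagInterval g U).1 :=
      ⟨fun p => M.map (hbp p) (u (b p)), fun p q h => by
        rw [M.map_map]
        exact hwd _ _ (hb p) (hb q) _ _ _⟩
    have hs : pmLimitProj M _ ⟨g top, hwmem⟩ s ≠ 0 := by
      intro h0
      have e : M.map (g.monotone hatop) (u (zigzagApex n)) = 0 :=
        (hwd _ _ hapex (hb _) _ _ _).trans h0
      have e2 := hφψ _ _ hatop hrow htrow (u (zigzagApex n))
      rw [e, hu _ hapex, map_zero] at e2
      simp at e2
    have h1 : Module.finrank F (M.obj (g top)) = 1 :=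
      ((LinearEquiv.ofBijective (ψ top) (hψ top htrow)).finrank_eq).trans (Module.finrank_self F)
    refine le_antisymm ((Submodule.finrank_le _).trans h1.le) ?_
    refine Nat.one_le_iff_ne_zero.mpr fun h0 => hs ?_
    have := Submodule.finrank_eq_zero.mp h0
    exact LinearMap.congr_fun (LinearMap.range_eq_bot.mp this) s

/-- The support of a generalized persistence diagram of a module over a poset which contains a
grid with zigzag structure is exponentially large. -/
theorem two_pow_le_ncard_support
    (hg : ∀ a b p, g a ≤ p → g b ≤ p → g (a ⊔ b) ≤ p) (hz : HasZigzagStructure n (M.restrict g))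
    {f : PosetInt P → ℤ} (hf : IsGPD M f) (hfin : (Function.support f).Finite) :
    2 ^ (n + 1) - 1 ≤ (Function.support f).ncard := by
  classical
  set s := hfin.toFinset with hs
  let base : PosetInt P → Prop := fun J =>
    g (Fin.last _, Fin.last _) ∈ J.1 ∧ g (zigzagApex n) ∈ J.1
  let miss : PosetInt P → Finset (Fin (n + 1)) := fun J =>
    Finset.univ.filter fun k => g (zigzagDiag n k) ∉ J.1
  -- The total of the diagram over the intervals whose set of missed diagonal indices is exactly
  -- `U`.
  let H : Finset (Fin (n + 1)) → ℤ := fun U => ∑ J ∈ s with base J ∧ miss J = U, f J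
  have hH : ∀ U : Finset (Fin (n + 1)), ∑ U' ∈ U.powerset, H U' = if U = ∅ then 0 else 1 := by
    intro U
    have e1 : (genRank M (zigzagInterval g U) : ℤ) =
        ∑ J ∈ s with (zigzagInterval g U).1 ⊆ J.1, f J := by
      rw [(hf _).2]
      refine finsum_mem_eq_sum_of_inter_support_eq (s := {J | (zigzagInterval g U).1 ⊆ J.1}) f ?_
      ext J
      simp [hs]
      tauto
    rw [genRank_zigzagInterval hg hz] at e1
    have e2 : (s.filter fun J => (zigzagInterval g U).1 ⊆ J.1) =
        U.powerset.biUnion fun U' => s.filter fun J => base J ∧ miss J = U' := by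
      ext J
      simp only [Finset.mem_filter, Finset.mem_biUnion, Finset.mem_powerset,
        zigzagInterval_subset_iff]
      constructor
      · rintro ⟨hJ, hb, h⟩
        refine ⟨miss J, fun k hk => ?_, hJ, hb, rfl⟩
        by_contra hkU
        exact (Finset.mem_filter.mp hk).2 (h k hkU)
      · rintro ⟨U', hU', hJ, hb, rfl⟩
        refine ⟨hJ, hb, fun k hk => ?_⟩
        by_contra h
        exact hk (hU' (Finset.mem_filter.mpr ⟨Finset.mem_univ _, h⟩))
    rw [e2, Finset.sum_biUnion] at e1
    · rw [← e1]; split_ifs <;> rfl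
    · intro U₁ _ U₂ _ hne
      refine Finset.disjoint_left.mpr fun J h1 h2 => hne ?_
      rw [Finset.mem_filter] at h1 h2
      exact h1.2.2.symm.trans h2.2.2
  -- A nonzero total `H U` forces an interval of the support with missing set `U`; different `U`
  -- need different intervals.
  have hsub : Finset.univ.erase ∅ ⊆ s.image miss := by
    intro U hU
    have hne : H U ≠ 0 := by
      rw [eq_of_sum_powerset_eq_ite H hH U, if_neg (Finset.ne_of_mem_erase hU)]
      simp
    obtain ⟨J, hJ, -⟩ := Finset.exists_ne_zero_of_sum_ne_zero hne
    rw [Finset.mem_filter] at hJ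
    exact Finset.mem_image.mpr ⟨J, hJ.1, hJ.2.2⟩
  have hcard := (Finset.card_le_card hsub).trans Finset.card_image_le
  rw [Finset.card_erase_of_mem (Finset.mem_univ _), Finset.card_univ, Fintype.card_finset,
    Fintype.card_fin] at hcard
  rwa [Set.ncard_eq_toFinset_card _ hfin]

theorem gpdSize_eq_ncard_support {f : PosetInt P → ℤ} (hf : IsGPD M f) :
    gpdSize M = (Function.support f).ncard := by
  have h : ∃ f, IsGPD M f := ⟨f, hf⟩
  rw [gpdSize, gpd, dif_pos h, h.choose_spec.unique hf]

theorem two_pow_le_gpdSize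
    (hg : ∀ a b p, g a ≤ p → g b ≤ p → g (a ⊔ b) ≤ p) (hz : HasZigzagStructure n (M.restrict g))
    (hM : ∃ f, IsGPD M f ∧ (Function.support f).Finite) : 2 ^ (n + 1) - 1 ≤ gpdSize M := by
  obtain ⟨f, hf, hfin⟩ := hM
  rw [gpdSize_eq_ncard_support hf]
  exact two_pow_le_ncard_support hg hz hf hfin

/-- A module with zigzag structure has an exponentially large diagram. -/
theorem HasZigzagStructure.two_pow_le_gpdSize
    {N : PersistenceModule.{w} F (Fin (n + 2) × Fin (n + 2))} (hN : HasZigzagStructure n N) :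
    2 ^ (n + 1) - 1 ≤ gpdSize N := by
  refine _root_.two_pow_le_gpdSize (M := N) (g := OrderHom.id) (fun a b p => sup_le) hN ?_
  exact (isIntervalSaturated_prodMap (OrderHom.id (α := Fin (n + 2)))
    (OrderHom.id (α := Fin (n + 2)))).exists_isGPD N (Set.toFinite _)

end ZigzagSize

/-! ### Existence of the diagram for degree bifiltrations -/

section DegreeBifiltrationDiagram

variable {V : Type*} [Finite V]

/-- The subcomplexes spanned by vertices of large degree, as a function of the degree and of the
complex. -/
def degreeSubcomplex : ℤᵒᵈ × PreAbstractSimplicialComplex V →o PreAbstractSimplicialComplex V where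
  toFun p :=
    { faces := {σ | σ ∈ p.2 ∧
        ∀ x ∈ σ, OrderDual.ofDual p.1 - 1 ≤ ((complexNeighbors p.2 x).ncard : ℤ)}
      isRelLowerSet_faces := fun {_} hσ =>
        ⟨(p.2.isRelLowerSet_faces hσ.1).1, fun _ hτσ hτ =>
          ⟨(p.2.isRelLowerSet_faces hσ.1).2 hτσ hτ, fun x hx => hσ.2 x (hτσ hx)⟩⟩ }
  monotone' := by
    rintro ⟨d, K⟩ ⟨e, L⟩ ⟨hde, hKL⟩ σ hσ
    refine ⟨hKL hσ.1, fun x hx => ?_⟩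
    have h1 : OrderDual.ofDual e ≤ OrderDual.ofDual d := hde
    have h2 : ((complexNeighbors K x).ncard : ℤ) ≤ (complexNeighbors L x).ncard := by
      refine Nat.cast_le.mpr (Set.ncard_le_ncard ?_ (Set.toFinite _))
      rintro y ⟨hy, τ, hτ, e⟩
      exact ⟨hy, τ, hKL hτ, e⟩
    have h3 := hσ.2 x hx
    simp only at h3 ⊢
    linarith

/-- The truncation of the degrees to a finite range. -/
def clampDegree (m : ℕ) : ℤᵒᵈ →o ℤᵒᵈ where
  -- With vertex degrees between `0` and `m`, the bound `d - 1` is vacuous for `d ≤ 0` and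
  -- unattainable for `d ≥ m + 2`, so this truncation changes no complex.
  toFun d := OrderDual.toDual (max 0 (min (OrderDual.ofDual d) (m + 2)))
  monotone' d e h := by
    have h' : OrderDual.ofDual e ≤ OrderDual.ofDual d := h
    exact max_le_max le_rfl (min_le_min h' le_rfl)

/-- This exhibits the bifiltration as a pullback along a product of monotone maps out of chains,
with finite range. -/
theorem degreeBifiltration_eq_comp (K : ℝ≥0 →o PreAbstractSimplicialComplex V) :
    degreeBifiltration K = degreeSubcomplex.comp ((clampDegree (Nat.card V)).prodMap K) := by
  refine OrderHom.ext _ _ (funext fun p => PreAbstractSimplicialComplex.ext (Set.ext fun σ => ?_))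
  refine and_congr_right fun _ => forall₂_congr fun x _ => ?_
  have h1 : (complexNeighbors (K p.2) x).ncard ≤ Nat.card V := by
    rw [← Set.ncard_univ]
    exact Set.ncard_le_ncard (Set.subset_univ _) (Set.toFinite _)
  change OrderDual.ofDual p.1 - 1 ≤ _ ↔ max 0 (min (OrderDual.ofDual p.1) _) - 1 ≤ _
  change _ ↔ _ ≤ ((complexNeighbors (K p.2) x).ncard : ℤ)
  omega

instance : Finite (PreAbstractSimplicialComplex V) :=
  Finite.of_injective (fun K => K.faces) fun _ _ => PreAbstractSimplicialComplex.ext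

/-- The homology of a degree bifiltration has a generalized persistence diagram with finite
support. -/
theorem exists_isGPD_degreeBifiltration (F : Type*) [Field F]
    (K : ℝ≥0 →o PreAbstractSimplicialComplex V) (m : ℕ) :
    ∃ f, IsGPD (filtrationHomology F (degreeBifiltration K) m) f ∧
      (Function.support f).Finite := by
  rw [degreeBifiltration_eq_comp]
  refine (isIntervalSaturated_prodMap (clampDegree (Nat.card V)) K).exists_isGPD
    (filtrationHomology F degreeSubcomplex m) ?_
  have h : (Set.Icc (OrderDual.toDual ((Nat.card V : ℤ) + 2)) (OrderDual.toDual 0)).Finite :=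
    Set.toFinite _
  refine (h.prod (Set.toFinite Set.univ)).subset ?_
  rintro _ ⟨p, rfl⟩
  refine ⟨⟨?_, ?_⟩, Set.mem_univ _⟩
  · change max 0 (min (OrderDual.ofDual p.1) _) ≤ (Nat.card V : ℤ) + 2
    exact max_le (by positivity) (min_le_right _ _)
  · change (0 : ℤ) ≤ max 0 _
    exact le_max_left _ _

end DegreeBifiltrationDiagram

/-! ### Detecting first homology by cocycles -/

section Cocycles

universe u v

variable {F : Type u} [Field F] {V : Type v} {K L : PreAbstractSimplicialComplex V}

theorem SpansSimplex.of_range_subset {m k : ℕ} {s : Fin m → V} {t : Fin (k + 1) → V}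
    (hs : SpansSimplex K s) (h : Set.range t ⊆ Set.range s) : SpansSimplex K t := by
  classical
  obtain ⟨σ, hσ, e⟩ := hs
  refine ⟨Finset.univ.image t, (K.isRelLowerSet_faces hσ).2 ?_ ?_, by simp⟩
  · intro x hx
    have : x ∈ (σ : Set V) := by
      rw [e]
      exact h (by simpa using hx)
    exact this
  · exact ⟨t 0, by simp⟩

/-- A simplicial `1`-cocycle on `K`. -/
def IsCocycle (K : PreAbstractSimplicialComplex V) (f : V → V → F) : Prop :=
  ∀ a b c, SpansSimplex K ![a, b, c] → f a b + f b c = f a c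

theorem IsCocycle.mono (h : K ≤ L) {f : V → V → F} (hf : IsCocycle L f) : IsCocycle K f :=
  fun a b c habc => hf a b c (habc.mono h)

/-- Tuples with repetitions also span simplices, so the cocycle identity on degenerate triples
yields normalisation, and likewise antisymmetry. -/
theorem IsCocycle.self {f : V → V → F} (hf : IsCocycle K f) {a : V} {m : ℕ} {s : Fin m → V}
    (hs : SpansSimplex K s) (ha : a ∈ Set.range s) : f a a = 0 := by
  have h := hf a a a (hs.of_range_subset (by
    rintro _ ⟨i, rfl⟩
    fin_cases i <;> simpa using ha))
  simpa using h

theorem IsCocycle.symm {f : V → V → F} (hf : IsCocycle K f) {a b : V} {m : ℕ} {s : Fin m → V}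
    (hs : SpansSimplex K s) (ha : a ∈ Set.range s) (hb : b ∈ Set.range s) : f b a = -f a b := by
  have h := hf a b a (hs.of_range_subset (by
    rintro _ ⟨i, rfl⟩
    fin_cases i <;> simpa))
  rw [hf.self hs ha] at h
  exact eq_neg_of_add_eq_zero_right h

/-- The value of a function on edges on a chain. -/
noncomputable def edgeEval (f : V → V → F) : ((Fin (1 + 1) → V) →₀ F) →ₗ[F] F :=
  Finsupp.linearCombination F fun s : Fin (1 + 1) → V => f (s 0) (s 1)

@[simp]
theorem edgeEval_single (f : V → V → F) (s : Fin (1 + 1) → V) (c : F) :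
    edgeEval f (Finsupp.single s c) = c * f (s 0) (s 1) := by
  simp [edgeEval]

theorem edgeEval_congr {f f' : V → V → F} (h : ∀ a b, SpansSimplex K ![a, b] → f a b = f' a b)
    {x : (Fin (1 + 1) → V) →₀ F} (hx : x ∈ tupleChains F K 1) : edgeEval f x = edgeEval f' x := by
  rw [edgeEval, edgeEval, Finsupp.linearCombination_apply, Finsupp.linearCombination_apply]
  refine Finsupp.sum_congr fun s hs => ?_
  have hs' : SpansSimplex K s := hx hs
  rw [h (s 0) (s 1) (hs'.of_range_subset (by
    rintro _ ⟨i, rfl⟩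
    fin_cases i <;> simp))]

theorem simplicialBoundary_single (m : ℕ) (s : Fin (m + 1 + 1) → V) (c : F) :
    simplicialBoundary F V m (Finsupp.single s c) =
      ∑ i : Fin (m + 1 + 1), (-1 : F) ^ (i : ℕ) • Finsupp.single (s ∘ i.succAbove) c := by
  simp [simplicialBoundary, LinearMap.sum_apply, Finsupp.lmapDomain_apply,
    Finsupp.mapDomain_single]

theorem simplicialBoundary_zero_single (s : Fin (0 + 1 + 1) → V) (c : F) :
    simplicialBoundary F V 0 (Finsupp.single s c) =
      Finsupp.single (s ∘ Fin.succAbove 0) c - Finsupp.single (s ∘ Fin.succAbove 1) c := by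
  rw [simplicialBoundary_single, Fin.sum_univ_two]
  simp [sub_eq_add_neg]

theorem edgeEval_boundary_single (f : V → V → F) (s : Fin (1 + 1 + 1) → V) (c : F) :
    edgeEval f (simplicialBoundary F V 1 (Finsupp.single s c)) =
      c * (f (s 0) (s 1) + f (s 1) (s 2) - f (s 0) (s 2)) := by
  rw [simplicialBoundary_single, map_sum, Fin.sum_univ_three]
  simp [Fin.succAbove]
  ring

/-- One-vertex tuples have neither repetitions nor nontrivial permutations; hence the boundary of a
`1`-cycle vanishes on the nose. -/
theorem orientationRel_zero (K : PreAbstractSimplicialComplex V) : orientationRel F K 0 = ⊥ := by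
  have : Subsingleton (Fin (0 + 1)) := inferInstanceAs (Subsingleton (Fin 1))
  rw [orientationRel, Submodule.span_eq_bot]
  rintro x (⟨s, -, hs, -⟩ | ⟨s, π, -, rfl⟩)
  · exact absurd (Function.injective_of_subsingleton s) hs
  · rw [Subsingleton.elim π 1]
    simp

/-- Evaluating a coboundary on a chain is evaluating `g` on its boundary. -/
theorem edgeEval_coboundary (g : V → F) {x : (Fin (1 + 1) → V) →₀ F}
    (hx : x ∈ simplicialCycles F K 1) : edgeEval (fun a b => g b - g a) x = 0 := by
  have key : edgeEval (fun a b => g b - g a) =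
      (Finsupp.linearCombination F fun s : Fin (0 + 1) → V => g (s 0)).comp
        (simplicialBoundary F V 0) := by
    refine Finsupp.lhom_ext fun s c => ?_
    rw [LinearMap.comp_apply, simplicialBoundary_zero_single, map_sub]
    simp [Fin.succAbove, mul_sub]
  have h : simplicialBoundary F V 0 x ∈ orientationRel F K 0 := hx.2
  rw [orientationRel_zero, Submodule.mem_bot] at h
  rw [key, LinearMap.comp_apply, h, map_zero]

theorem tupleChains_eq_span (m : ℕ) : tupleChains F K m =
    Submodule.span F ((fun s => Finsupp.single s 1) '' {s | SpansSimplex K s}) :=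
  Finsupp.supported_eq_span_single F _

/-- The cocycle identity kills boundaries of triangles; normalisation and antisymmetry kill the
orientation relations. -/
theorem IsCocycle.edgeEval_eq_zero {f : V → V → F} (hf : IsCocycle K f)
    {x : (Fin (1 + 1) → V) →₀ F} (hx : x ∈ simplicialBoundaries F K 1) : edgeEval f x = 0 := by
  suffices simplicialBoundaries F K 1 ≤ LinearMap.ker (edgeEval f) from this hx
  refine sup_le ?_ ?_
  · rw [Submodule.map_le_iff_le_comap, tupleChains_eq_span, Submodule.span_le]
    rintro _ ⟨s, hs, rfl⟩
    change edgeEval f _ = 0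
    rw [edgeEval_boundary_single, hf, sub_self, mul_zero]
    have e : ![s 0, s 1, s 2] = s := by
      ext i
      fin_cases i <;> rfl
    exact e.symm ▸ hs
  · refine Submodule.span_le.mpr ?_
    rintro x (⟨s, hs, hinj, rfl⟩ | ⟨s, π, hs, rfl⟩)
    · have h01 : s 0 = s 1 := by
        by_contra h
        refine hinj fun i j hij => ?_
        fin_cases i <;> fin_cases j <;> simp_all
      change edgeEval f _ = 0
      rw [edgeEval_single, ← h01, hf.self hs ⟨0, rfl⟩, mul_zero]
    · change edgeEval f _ = 0
      rw [map_sub, map_smul, edgeEval_single, edgeEval_single]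
      have hπ : π = 1 ∨ π = Equiv.swap 0 1 := by
        revert π
        decide
      rcases hπ with rfl | rfl
      · simp
      · simp [hf.symm hs ⟨0, rfl⟩ ⟨1, rfl⟩]

open Classical in
/-- The linear form on first homology given by a cocycle (zero if `f` is not a cocycle). -/
noncomputable def cocycleEval (K : PreAbstractSimplicialComplex V) (f : V → V → F) :
    SimplicialHomology F K 1 →ₗ[F] F :=
  if hf : IsCocycle K f then
    Submodule.liftQ _ ((edgeEval f).comp (simplicialCycles F K 1).subtype)
      fun _ hx => hf.edgeEval_eq_zero hx
  else 0

theorem IsCocycle.cocycleEval_mk {f : V → V → F} (hf : IsCocycle K f)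
    (x : simplicialCycles F K 1) :
    cocycleEval K f (Submodule.Quotient.mk x) = edgeEval f x.1 := by
  rw [cocycleEval, dif_pos hf]
  rfl

theorem IsCocycle.cocycleEval_map {f : V → V → F} (hf : IsCocycle L f) (h : K ≤ L)
    (x : SimplicialHomology F K 1) :
    cocycleEval L f (simplicialHomologyMap F h 1 x) = cocycleEval K f x := by
  obtain ⟨x, rfl⟩ := Submodule.Quotient.mk_surjective _ x
  rw [(hf.mono h).cocycleEval_mk]
  exact hf.cocycleEval_mk _

/-- A class on which all linear forms vanish is zero; if the cocycles on `K` are spanned, up to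
coboundaries, by a finite family, then the linear forms of this family suffice. -/
theorem eq_zero_of_cocycleEval_eq_zero {ι : Type*} [Fintype ι] (θ : ι → V → V → F)
    (hθ : ∀ i, IsCocycle K (θ i))
    (h : ∀ f : V → V → F, IsCocycle K f → ∃ (c : ι → F) (g : V → F), ∀ a b,
      SpansSimplex K ![a, b] → f a b = g b - g a + ∑ i, c i * θ i a b)
    (x : SimplicialHomology F K 1) (hx : ∀ i, cocycleEval K (θ i) x = 0) : x = 0 := by
  obtain ⟨x, rfl⟩ := Submodule.Quotient.mk_surjective _ x
  refine (Module.forall_dual_apply_eq_zero_iff F _).mp fun lam => ?_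
  -- A linear form on homology, extended to all edge chains, is evaluation of a function on edges.
  -- Since `lam` vanishes on boundaries, this function is a cocycle, and the assumed classification
  -- applies to it.
  obtain ⟨lam', hlam'⟩ := (lam.comp (Submodule.mkQ _)).exists_extend
  have hext : ∀ y : simplicialCycles F K 1, lam (Submodule.Quotient.mk y) = lam' y.1 := fun y =>
    (LinearMap.congr_fun hlam' y).symm
  have hedge : lam' = edgeEval fun a b => lam' (Finsupp.single ![a, b] 1) := by
    refine Finsupp.lhom_ext fun s c => ?_
    have hs : s = ![s 0, s 1] := by
      ext i
      fin_cases i <;> rfl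
    rw [edgeEval_single, ← hs, ← smul_eq_mul, ← map_smul, Finsupp.smul_single, smul_eq_mul,
      mul_one]
  have hcoc : IsCocycle K fun a b => lam' (Finsupp.single ![a, b] 1) := by
    intro a b c habc
    have e := edgeEval_boundary_single (fun a b => lam' (Finsupp.single ![a, b] 1)) ![a, b, c] 1
    rw [← hedge] at e
    have hb : simplicialBoundary F V 1 (Finsupp.single ![a, b, c] 1) ∈
        simplicialBoundaries F K 1 :=
      Submodule.mem_sup_left ⟨_, Finsupp.single_mem_supported F _ habc, rfl⟩
    have hz : simplicialBoundary F V 1 (Finsupp.single ![a, b, c] 1) ∈ simplicialCycles F K 1 := by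
      constructor
      · rw [simplicialBoundary_single]
        refine Submodule.sum_mem _ fun i _ => Submodule.smul_mem _ _ ?_
        exact Finsupp.single_mem_supported F _
          (habc.of_range_subset (Set.range_comp_subset_range _ _))
      · change simplicialBoundary F V 0 _ ∈ orientationRel F K 0
        have : simplicialBoundary F V 0 (simplicialBoundary F V 1 (Finsupp.single ![a, b, c] 1)) =
            0 := by
          rw [simplicialBoundary_single, map_sum, Fin.sum_univ_three]
          simp only [map_smul, simplicialBoundary_zero_single]
          have e1 : (![a, b, c] ∘ Fin.succAbove 0) ∘ Fin.succAbove 0 =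
              (![a, b, c] ∘ Fin.succAbove 1) ∘ Fin.succAbove (0 : Fin 2) := by
            ext i; fin_cases i; rfl
          have e2 : (![a, b, c] ∘ Fin.succAbove 0) ∘ Fin.succAbove 1 =
              (![a, b, c] ∘ Fin.succAbove 2) ∘ Fin.succAbove (0 : Fin 2) := by
            ext i; fin_cases i; rfl
          have e3 : (![a, b, c] ∘ Fin.succAbove 1) ∘ Fin.succAbove 1 =
              (![a, b, c] ∘ Fin.succAbove 2) ∘ Fin.succAbove (1 : Fin 2) := by
            ext i; fin_cases i; rfl
          rw [e1, e2, e3]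
          simp
        rw [this]
        exact Submodule.zero_mem _
    have hb' : (Submodule.Quotient.mk ⟨_, hz⟩ : SimplicialHomology F K 1) = 0 :=
      (Submodule.Quotient.mk_eq_zero _).mpr hb
    rw [← hext ⟨_, hz⟩, hb', map_zero, one_mul] at e
    exact sub_eq_zero.mp e.symm
  obtain ⟨c, g, hcg⟩ := h _ hcoc
  rw [hext, hedge, edgeEval_congr hcg x.2.1]
  have hsplit : edgeEval (fun a b => g b - g a + ∑ i, c i * θ i a b) =
      edgeEval (fun a b => g b - g a) + ∑ i, c i • edgeEval (θ i) := by
    refine Finsupp.lhom_ext fun s d => ?_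
    simp [LinearMap.sum_apply, mul_add, Finset.mul_sum, mul_left_comm]
  rw [hsplit, LinearMap.add_apply, edgeEval_coboundary g x.2, LinearMap.sum_apply, zero_add]
  refine Finset.sum_eq_zero fun i _ => ?_
  have := hx i
  rw [(hθ i).cocycleEval_mk] at this
  rw [LinearMap.smul_apply, this, smul_zero]

/-- The homology class of a closed walk of length `4`. -/
theorem exists_square_class (s : Fin 4 → V) (hs : ∀ q, SpansSimplex K ![s q, s (q + 1)]) :
    ∃ x : SimplicialHomology F K 1, ∀ f, IsCocycle K f →
      cocycleEval K f x = ∑ q, f (s q) (s (q + 1)) := by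
  have hz : ∑ q, Finsupp.single ![s q, s (q + 1)] (1 : F) ∈ simplicialCycles F K 1 := by
    constructor
    · exact Submodule.sum_mem _ fun q _ => Finsupp.single_mem_supported F _ (hs q)
    · change simplicialBoundary F V 0 _ ∈ orientationRel F K 0
      have h : ∀ q, simplicialBoundary F V 0 (Finsupp.single ![s q, s (q + 1)] (1 : F)) =
          Finsupp.single ![s (q + 1)] 1 - Finsupp.single ![s q] 1 := by
        intro q
        rw [simplicialBoundary_zero_single]
        have e1 : ![s q, s (q + 1)] ∘ Fin.succAbove 0 = ![s (q + 1)] := by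
          ext i; fin_cases i; rfl
        have e2 : ![s q, s (q + 1)] ∘ Fin.succAbove 1 = ![s q] := by
          ext i; fin_cases i; rfl
        rw [e1, e2]
      -- Addition in `Fin 4` is cyclic, so the walk closes up and its boundary cancels.
      have hsum : ∑ q, Finsupp.single ![s (q + 1)] (1 : F) = ∑ q, Finsupp.single ![s q] 1 :=
        Equiv.sum_comp (Equiv.addRight (1 : Fin 4)) fun q => Finsupp.single ![s q] (1 : F)
      rw [map_sum]
      simp only [h]
      rw [Finset.sum_sub_distrib, hsum, sub_self]
      exact Submodule.zero_mem _
  refine ⟨Submodule.Quotient.mk ⟨_, hz⟩, fun f hf => ?_⟩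
  rw [hf.cocycleEval_mk, map_sum]
  simp

end Cocycles

/-! ### The combinatorics of the witness -/

section WitnessGraph

/-- Labels of the points of the witness: a layer, a direction, and a slot, which is `none` for the
point of the inner square and `some j` for the points of the outer cluster. -/
abbrev WitnessIndex (n : ℕ) : Type := Fin (n + 1) × Fin 4 × Option (Fin (n + 1))

/-- The index of the scale at which the `j`-th point of a cluster in layer `i` gets attached to
the inner square. -/
def attachIndex (i j : ℕ) : ℕ := if j = i then i + 1 else j

theorem attachIndex_le {n i j : ℕ} (hj : j ≤ n) : attachIndex i j ≤ n + 1 := by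
  unfold attachIndex
  split_ifs <;> omega

/-- Adjacency of slots at the scale with index `s`, for points in the layers `i` and `i'` and in
the directions `q` and `q'`. -/
def slotAdj {n : ℕ} (s : ℕ) (i i' : Fin (n + 1)) (q q' : Fin 4) :
    Option (Fin (n + 1)) → Option (Fin (n + 1)) → Prop
  | none, none => q' ≠ q + 2
  | none, some j => q = q' ∧ attachIndex i' j ≤ s
  | some j, none => q = q' ∧ attachIndex i j ≤ s
  | some _, some _ => q = q'

/-- Adjacency of layers at the scale with index `s`. -/
def layerAdj {n : ℕ} (s : ℕ) (i i' : Fin (n + 1)) : Prop :=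
  i = i' ∨ (s = n + 1 ∧ ((i : ℕ) + 1 = i' ∨ (i' : ℕ) + 1 = i))

/-- Adjacency in the 1-skeleton of the Rips complex of the witness at the scale with index `s`. -/
def witnessAdj {n : ℕ} (s : ℕ) (u v : WitnessIndex n) : Prop :=
  layerAdj s u.1 v.1 ∧ slotAdj s u.1 v.1 u.2.1 v.2.1 u.2.2 v.2.2

variable {n s : ℕ}

theorem ne_add_two (q : Fin 4) : q ≠ q + 2 := by
  revert q
  decide

theorem ne_add_two_symm {q q' : Fin 4} : q' ≠ q + 2 → q ≠ q' + 2 := by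
  revert q q'
  decide

theorem layerAdj.symm {i i' : Fin (n + 1)} (h : layerAdj s i i') : layerAdj s i' i := by
  rcases h with h | ⟨h, h' | h'⟩
  exacts [Or.inl h.symm, Or.inr ⟨h, Or.inr h'⟩, Or.inr ⟨h, Or.inl h'⟩]

theorem layerAdj.eq {i i' : Fin (n + 1)} (h : layerAdj s i i') (hs : s ≤ n) : i = i' :=
  h.resolve_right fun h' => by omega

theorem witnessAdj_refl (u : WitnessIndex n) : witnessAdj s u u := by
  refine ⟨Or.inl rfl, ?_⟩
  obtain ⟨i, q, _ | j⟩ := u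
  · exact ne_add_two q
  · exact rfl

theorem witnessAdj.symm {u v : WitnessIndex n} (h : witnessAdj s u v) : witnessAdj s v u := by
  obtain ⟨i, q, m⟩ := u
  obtain ⟨i', q', m'⟩ := v
  refine ⟨h.1.symm, ?_⟩
  have h2 := h.2
  rcases m with _ | j <;> rcases m' with _ | j'
  · exact ne_add_two_symm h2
  · exact ⟨h2.1.symm, h2.2⟩
  · exact ⟨h2.1.symm, h2.2⟩
  · exact Eq.symm h2

/-- The cocycle of the `4`-cycle of directions. -/
def squareCocycle (F : Type*) [Field F] (q q' : Fin 4) : F :=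
  if q = 0 ∧ q' = 1 then 1 else if q = 1 ∧ q' = 0 then -1 else 0

variable {F : Type*} [Field F]

/-- Three distinct directions always include an opposite pair, so two of these three coincide. -/
theorem squareCocycle_add {q q' q'' : Fin 4} (h : q' ≠ q + 2) (h' : q'' ≠ q' + 2)
    (h'' : q'' ≠ q + 2) :
    squareCocycle F q q' + squareCocycle F q' q'' = squareCocycle F q q'' := by
  revert h h' h''
  fin_cases q <;> fin_cases q' <;> fin_cases q'' <;> simp [squareCocycle]

theorem squareCocycle_self (q : Fin 4) : squareCocycle F q q = 0 := by
  fin_cases q <;> simp [squareCocycle]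

theorem squareCocycle_symm (q q' : Fin 4) : squareCocycle F q' q = -squareCocycle F q q' := by
  fin_cases q <;> fin_cases q' <;> simp [squareCocycle]

/-- The direction projects the graph at every scale to the 4-cycle, so the square cocycle pulls
back. -/
theorem witnessAdj.dir_ne {u v : WitnessIndex n} (h : witnessAdj s u v) : v.2.1 ≠ u.2.1 + 2 := by
  obtain ⟨i, q, m⟩ := u
  obtain ⟨i', q', m'⟩ := v
  have h2 := h.2
  have hq := ne_add_two q
  rcases m with _ | j <;> rcases m' with _ | j'
  · exact h2
  · obtain ⟨rfl, -⟩ : q = q' ∧ _ := h2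
    exact hq
  · obtain ⟨rfl, -⟩ : q = q' ∧ _ := h2
    exact hq
  · obtain rfl : q = q' := h2
    exact hq

/-- Simplicial cocycles on the flag complex of the graph `witnessAdj s` restricted to the vertices
satisfying `pres`. -/
def IsWitnessCocycle (s : ℕ) (pres : WitnessIndex n → Prop)
    (f : WitnessIndex n → WitnessIndex n → F) : Prop :=
  ∀ u v w, pres u → pres v → pres w → witnessAdj s u v → witnessAdj s v w → witnessAdj s u w →
    f u v + f v w = f u w

namespace IsWitnessCocycle

variable {pres : WitnessIndex n → Prop} {f : WitnessIndex n → WitnessIndex n → F}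

theorem self (hf : IsWitnessCocycle s pres f) {u : WitnessIndex n} (hu : pres u) : f u u = 0 := by
  simpa using hf u u u hu hu hu (witnessAdj_refl u) (witnessAdj_refl u) (witnessAdj_refl u)

theorem symm (hf : IsWitnessCocycle s pres f) {u v : WitnessIndex n} (hu : pres u) (hv : pres v)
    (h : witnessAdj s u v) : f v u = -f u v := by
  have := hf u v u hu hv hu h h.symm (witnessAdj_refl u)
  rw [hf.self hu] at this
  exact eq_neg_of_add_eq_zero_right this

/-- A potential for `f` on the inner squares with prescribed value in direction `0`, which
accounts for all edges of the squares but those joining the directions `0` and `1`. -/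
def squarePotential (f : WitnessIndex n → WitnessIndex n → F) (G : Fin (n + 1) → F)
    (i : Fin (n + 1)) : Fin 4 → F :=
  ![G i,
    G i + f (i, 0, none) (i, 3, none) + f (i, 3, none) (i, 2, none) + f (i, 2, none) (i, 1, none),
    G i + f (i, 0, none) (i, 3, none) + f (i, 3, none) (i, 2, none),
    G i + f (i, 0, none) (i, 3, none)]

/-- The holonomy of `f` along an inner square. -/
def holonomy (f : WitnessIndex n → WitnessIndex n → F) (i : Fin (n + 1)) : F :=
  f (i, 0, none) (i, 1, none) - f (i, 0, none) (i, 3, none) - f (i, 3, none) (i, 2, none) -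
    f (i, 2, none) (i, 1, none)

/-- The potential integrates `f` along `0, 3, 2, 1`; the closing edge between `0` and `1` carries
the whole holonomy. -/
theorem square_edge (hf : IsWitnessCocycle s pres f) (G : Fin (n + 1) → F) (i : Fin (n + 1))
    {q q' : Fin 4} (h : pres (i, q, none)) (h' : pres (i, q', none)) (hqq' : q' ≠ q + 2) :
    f (i, q, none) (i, q', none) = squarePotential f G i q' - squarePotential f G i q +
      holonomy f i * squareCocycle F q q' := by
  have hadj : witnessAdj s ((i, q, none) : WitnessIndex n) (i, q', none) := ⟨Or.inl rfl, hqq'⟩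
  have hself := hf.self h
  have hsymm := hf.symm h h' hadj
  revert hqq'
  fin_cases q <;> fin_cases q' <;> intro hqq' <;>
    first
    | exact absurd rfl hqq'
    | (simp only [squarePotential, holonomy, squareCocycle] at *
       simp at * <;>
       first
       | linear_combination hself
       | linear_combination hsymm
       | linear_combination -hsymm
       | ring)

/-- A cluster is a clique, so integrating from any base point gives a potential. If some cluster
point is attached to the inner point, it serves as base point and fixes the constant relative to
`b`; otherwise the constant is free. -/
theorem exists_clusterPotential (hf : IsWitnessCocycle s pres f) (i : Fin (n + 1)) (q : Fin 4)
    (b : F) : ∃ g : Fin (n + 1) → F,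
      (∀ j j', pres (i, q, some j) → pres (i, q, some j') →
        f (i, q, some j) (i, q, some j') = g j' - g j) ∧
      ∀ j, pres (i, q, none) → pres (i, q, some j) → attachIndex i j ≤ s →
        f (i, q, none) (i, q, some j) = g j - b := by
  have hadj : ∀ j j', witnessAdj s ((i, q, some j) : WitnessIndex n) (i, q, some j') :=
    fun _ _ => ⟨Or.inl rfl, rfl⟩
  by_cases h : ∃ j, pres (i, q, none) ∧ pres (i, q, some j) ∧ attachIndex i j ≤ s
  · obtain ⟨j₀, h0, h1, h2⟩ := h
    refine ⟨fun j => b + f (i, q, none) (i, q, some j₀) + f (i, q, some j₀) (i, q, some j),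
      fun j j' hj hj' => ?_, fun j _ hj hja => ?_⟩
    · linear_combination hf _ _ _ h1 hj hj' (hadj _ _) (hadj _ _) (hadj _ _)
    · rw [← hf _ _ _ h0 h1 hj ⟨Or.inl rfl, rfl, h2⟩ (hadj _ _) ⟨Or.inl rfl, rfl, hja⟩]
      ring
  · by_cases h' : ∃ j, pres (i, q, some j)
    · obtain ⟨j₀, h1⟩ := h'
      refine ⟨fun j => f (i, q, some j₀) (i, q, some j),
        fun j j' hj hj' => ?_, fun j h0 hj hja => absurd ⟨j, h0, hj, hja⟩ h⟩
      linear_combination hf _ _ _ h1 hj hj' (hadj _ _) (hadj _ _) (hadj _ _)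
    · exact ⟨0, fun j _ hj => absurd ⟨j, hj⟩ h', fun j _ hj => absurd ⟨j, hj⟩ h'⟩

/-- Below the last scale, a cocycle is determined up to a coboundary by its holonomies. -/
theorem exists_potential_of_le (hf : IsWitnessCocycle s pres f) (hs : s ≤ n) :
    ∃ (c : Fin (n + 1) → F) (g : WitnessIndex n → F), ∀ u v, pres u → pres v → witnessAdj s u v →
      f u v = g v - g u + c u.1 * squareCocycle F u.2.1 v.2.1 := by
  -- Layers are not yet joined, so each square may start its potential at `0`; the clusters are
  -- matched to the square.
  choose gc hgc hgc' using fun i q => hf.exists_clusterPotential i q (squarePotential f 0 i q)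
  let g : WitnessIndex n → F := fun u => u.2.2.elim (squarePotential f 0 u.1 u.2.1) (gc u.1 u.2.1)
  refine ⟨holonomy f, g, ?_⟩
  rintro ⟨i, q, m⟩ ⟨i', q', m'⟩ hu hv h
  obtain rfl : i = i' := h.1.eq hs
  have h2 := h.2
  rcases m with _ | j <;> rcases m' with _ | j'
  · exact hf.square_edge 0 i hu hv h2
  · obtain ⟨rfl, ha⟩ : q = q' ∧ _ := h2
    rw [hgc' i q j' hu hv ha, squareCocycle_self]
    simp [g]
  · obtain ⟨rfl, ha⟩ : q = q' ∧ _ := h2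
    rw [hf.symm hv hu h.symm, hgc' i q j hv hu ha, squareCocycle_self]
    simp [g]
  · obtain rfl : q = q' := h2
    rw [hgc i q j j' hu hv, squareCocycle_self]
    simp [g]

/-- At the last scale, a cocycle is determined up to a coboundary by a single holonomy. -/
theorem exists_potential_of_eq (hf : IsWitnessCocycle (n + 1) pres f)
    (hpres : ∀ i q, pres (i, q, none)) :
    ∃ (c : F) (g : WitnessIndex n → F), ∀ u v, pres u → pres v → witnessAdj (n + 1) u v →
      f u v = g v - g u + c * squareCocycle F u.2.1 v.2.1 := by
  -- Starting values obtained by integrating `f` along the column of inner points in direction `0`.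
  obtain ⟨G, hG⟩ : ∃ G : Fin (n + 1) → F, ∀ i i' : Fin (n + 1), (i : ℕ) + 1 = i' →
      f (i, 0, none) (i', 0, none) = G i' - G i := by
    refine ⟨fun i => ∑ m ∈ Finset.range i,
      f (Fin.ofNat (n + 1) m, 0, none) (Fin.ofNat (n + 1) (m + 1), 0, none), fun i i' h => ?_⟩
    have hi : Fin.ofNat (n + 1) i = i := by simp
    have hi' : Fin.ofNat (n + 1) (i + 1) = i' := by rw [h]; simp
    beta_reduce
    rw [← h, Finset.sum_range_succ, hi, hi']
    ring
  set P := squarePotential f G with hP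
  have hsq := fun i {q q'} hqq' => hf.square_edge G i (hpres i q) (hpres i q') hqq'
  have hadj : ∀ {i i' : Fin (n + 1)} {q q' : Fin 4}, (i = i' ∨ (i : ℕ) + 1 = i') → q' ≠ q + 2 →
      witnessAdj (n + 1) ((i, q, none) : WitnessIndex n) (i', q', none) := by
    intro i i' q q' h h'
    exact ⟨h.imp_right fun h => ⟨rfl, Or.inl h⟩, h'⟩
  have hq0 := ne_add_two
  -- The diagonal of a prism wall is computed through each of its two triangles. Comparing the
  -- results propagates exactness of vertical edges from direction `0` to `3`, `2`, `1`; the last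
  -- wall then equates the holonomies of consecutive layers.
  have hcomm : ∀ {i i' : Fin (n + 1)} {q q' : Fin 4}, (i : ℕ) + 1 = i' → q' ≠ q + 2 →
      f (i, q, none) (i', q', none) = P i q' - P i q + holonomy f i * squareCocycle F q q' +
        f (i, q', none) (i', q', none) ∧
      f (i, q, none) (i', q', none) = f (i, q, none) (i', q, none) +
        (P i' q' - P i' q + holonomy f i' * squareCocycle F q q') := by
    intro i i' q q' h h'
    rw [← hsq i h', ← hsq i' h']
    exact ⟨(hf _ _ _ (hpres _ _) (hpres _ _) (hpres _ _) (hadj (Or.inl rfl) h')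
        (hadj (Or.inr h) (hq0 _)) (hadj (Or.inr h) h')).symm,
      (hf _ _ _ (hpres _ _) (hpres _ _) (hpres _ _) (hadj (Or.inr h) (hq0 _))
        (hadj (Or.inl rfl) h') (hadj (Or.inr h) h')).symm⟩
  have hvert : ∀ {i i' : Fin (n + 1)}, (i : ℕ) + 1 = i' →
      (∀ q, f (i, q, none) (i', q, none) = P i' q - P i q) ∧ holonomy f i = holonomy f i' := by
    intro i i' h
    have h0 : f (i, 0, none) (i', 0, none) = P i' 0 - P i 0 := hG i i' h
    have step : ∀ {q q'}, q' ≠ q + 2 → squareCocycle F q q' = 0 →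
        f (i, q, none) (i', q, none) = P i' q - P i q →
        f (i, q', none) (i', q', none) = P i' q' - P i q' := by
      intro q q' hqq' hc hq
      have e := (hcomm h hqq').1.symm.trans (hcomm h hqq').2
      rw [hc, hq] at e
      linear_combination e
    have h3 := step (q := 0) (q' := 3) (by decide) (by simp [squareCocycle]) h0
    have h2 := step (q := 3) (q' := 2) (by decide) (by simp [squareCocycle]) h3
    have h1 := step (q := 2) (q' := 1) (by decide) (by simp [squareCocycle]) h2
    refine ⟨fun q => ?_, ?_⟩
    · fin_cases q
      exacts [h0, h1, h2, h3]
    · have e := (hcomm h (q := 0) (q' := 1) (by decide)).1.symm.trans (hcomm h (by decide)).2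
      have hc : squareCocycle F 0 1 = 1 := by simp [squareCocycle]
      rw [h0, h1, hc] at e
      linear_combination e
  have hhol : ∀ i, holonomy f i = holonomy f (0 : Fin (n + 1)) := by
    intro i
    induction i using Fin.induction with
    | zero => rfl
    | succ i ih => exact (hvert (i := i.castSucc) (i' := i.succ) (by simp)).2.symm.trans ih
  have hup : ∀ {i i' : Fin (n + 1)} {q q' : Fin 4}, (i = i' ∨ (i : ℕ) + 1 = i') → q' ≠ q + 2 →
      f (i, q, none) (i', q', none) = P i' q' - P i q +
        holonomy f (0 : Fin (n + 1)) * squareCocycle F q q' := by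
    rintro i i' q q' (rfl | h) h'
    · rw [hsq i h', hhol]
    · rw [(hcomm h h').1, (hvert h).1, hhol]
      ring
  have hall : ∀ {i i' : Fin (n + 1)} {q q' : Fin 4}, layerAdj (n + 1) i i' → q' ≠ q + 2 →
      f (i, q, none) (i', q', none) = P i' q' - P i q +
        holonomy f (0 : Fin (n + 1)) * squareCocycle F q q' := by
    rintro i i' q q' (h | ⟨-, h | h⟩) h'
    · exact hup (Or.inl h) h'
    · exact hup (Or.inr h) h'
    · have h'' := ne_add_two_symm h'
      rw [hf.symm (hpres _ _) (hpres _ _) (hadj (Or.inr h) h''), hup (Or.inr h) h'',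
        squareCocycle_symm]
      ring
  -- At this scale every outer point is attached to its inner point, which determines its potential.
  let g : WitnessIndex n → F := fun u =>
    u.2.2.elim (P u.1 u.2.1) fun j => P u.1 u.2.1 + f (u.1, u.2.1, none) u
  have hatt : ∀ (i j : Fin (n + 1)), attachIndex i j ≤ n + 1 := fun i j =>
    attachIndex_le (Nat.lt_succ_iff.mp j.2)
  have hmixed : ∀ {i i' : Fin (n + 1)} {q : Fin 4} {j : Fin (n + 1)}, layerAdj (n + 1) i i' →
      pres (i', q, some j) →
      f (i, q, none) (i', q, some j) = g (i', q, some j) - P i q := by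
    intro i i' q j h hj
    rw [← hf _ (i', q, none) _ (hpres _ _) (hpres _ _) hj ⟨h, hq0 q⟩ ⟨Or.inl rfl, rfl, hatt _ _⟩
      ⟨h, rfl, hatt _ _⟩, hall h (hq0 q), squareCocycle_self]
    simp [g]
    ring
  refine ⟨holonomy f (0 : Fin (n + 1)), g, ?_⟩
  rintro ⟨i, q, m⟩ ⟨i', q', m'⟩ hu hv h
  have h2 := h.2
  rcases m with _ | j <;> rcases m' with _ | j'
  · exact hall h.1 h2
  · obtain ⟨rfl, ha⟩ : q = q' ∧ _ := h2
    rw [hmixed h.1 hv, squareCocycle_self]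
    simp [g]
  · obtain ⟨rfl, ha⟩ : q = q' ∧ _ := h2
    rw [hf.symm hv hu h.symm, hmixed h.1.symm hu, squareCocycle_self]
    simp [g]
  · obtain rfl : q = q' := h2
    rw [← hf _ (i, q, none) _ hu (hpres _ _) hv ⟨Or.inl rfl, rfl, hatt _ _⟩ ⟨h.1, rfl, hatt _ _⟩ h,
      hmixed h.1 hv, hf.symm (hpres _ _) hu ⟨Or.inl rfl, rfl, hatt _ _⟩, hmixed (Or.inl rfl) hu,
      squareCocycle_self]
    ring

end IsWitnessCocycle

end WitnessGraph

/-! ### The geometry of the witness -/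

section WitnessGeometry

theorem dist_vec_three_le_iff {x y z x' y' z' r : ℝ} (hr : 0 ≤ r) :
    dist ![x, y, z] ![x', y', z'] ≤ r ↔ |x - x'| ≤ r ∧ |y - y'| ≤ r ∧ |z - z'| ≤ r := by
  rw [dist_pi_le_iff hr]
  simp [Fin.forall_fin_succ, Real.dist_eq]

/-- The point with radial component `t` in direction `q`, tangential component `τ` and height `z`. -/
def dirPoint (q : Fin 4) (t τ z : ℝ) : Fin 3 → ℝ :=
  (![![t, τ, z], ![-τ, t, z], ![-t, -τ, z], ![τ, -t, z]] : Fin 4 → Fin 3 → ℝ) q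

variable {t t' τ τ' z z' r : ℝ}

/-- Directions differ by quarter turns, which are isometries of the supremum metric, so only the
relative direction matters here and in the next two lemmas. -/
theorem dist_dirPoint_same (hr : 0 ≤ r) (q : Fin 4) :
    dist (dirPoint q t τ z) (dirPoint q t' τ' z') ≤ r ↔
      (|t - t'| ≤ r ∧ |τ - τ'| ≤ r) ∧ |z - z'| ≤ r := by
  fin_cases q <;> simp only [dirPoint] <;> refine (dist_vec_three_le_iff hr).trans ?_ <;>
    simp only [abs_le] <;> constructor <;> grind

theorem dist_dirPoint_next (hr : 0 ≤ r) (q : Fin 4) :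
    dist (dirPoint q t τ z) (dirPoint (q + 1) t' τ' z') ≤ r ↔
      (|t + τ'| ≤ r ∧ |t' - τ| ≤ r) ∧ |z - z'| ≤ r := by
  fin_cases q <;> simp only [dirPoint] <;> refine (dist_vec_three_le_iff hr).trans ?_ <;>
    simp only [abs_le] <;> constructor <;> grind

theorem dist_dirPoint_opposite (hr : 0 ≤ r) (q : Fin 4) :
    dist (dirPoint q t τ z) (dirPoint (q + 2) t' τ' z') ≤ r ↔
      (|t + t'| ≤ r ∧ |τ + τ'| ≤ r) ∧ |z - z'| ≤ r := by
  fin_cases q <;> simp only [dirPoint] <;> refine (dist_vec_three_le_iff hr).trans ?_ <;>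
    simp only [abs_le] <;> constructor <;> grind

theorem spacePoint_dirA (t z : ℝ) (q : Fin 4) : spacePoint t (dirA q) z = dirPoint q t 0 z := by
  fin_cases q <;> simp [spacePoint, dirA, dirPoint]

theorem spacePoint_dirB (t ε z : ℝ) (q : Fin 4) :
    spacePoint t (dirB ε q) z = dirPoint q t (t * ε) z := by
  fin_cases q <;> simp [spacePoint, dirB, dirPoint]

variable {n : ℕ}

/-- The radial component of a point of the witness. -/
noncomputable def witnessRadius (i : Fin (n + 1)) : Option (Fin (n + 1)) → ℝ
  | none => scaleB n 0
  | some j => scaleB n 0 + scaleB n (attachIndex i j)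

/-- The tangential component of a point of the witness. -/
noncomputable def witnessTilt (i : Fin (n + 1)) : Option (Fin (n + 1)) → ℝ
  | none => 0
  | some j => if j = i then (scaleB n 0 + scaleB n (i + 1)) * (1 / (n : ℝ) ^ 2) else 0

/-- The point of the witness with a given label. -/
noncomputable def witnessPoint (u : WitnessIndex n) : Fin 3 → ℝ :=
  dirPoint u.2.1 (witnessRadius u.1 u.2.2) (witnessTilt u.1 u.2.2)
    ((n + 1 / (n : ℝ) ^ 2) * (u.1 : ℕ))

theorem mem_witnessSet_iff {p : Fin 3 → ℝ} :
    p ∈ witnessSet n ↔ ∃ u : WitnessIndex n, witnessPoint u = p := by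
  simp only [witnessSet, Finset.mem_biUnion, Finset.mem_range, Finset.mem_union, Finset.mem_image,
    Finset.mem_univ, true_and, Finset.mem_erase, spacePoint_dirA, spacePoint_dirB]
  constructor
  · rintro ⟨i, hi, (⟨q, rfl⟩ | ⟨j, ⟨hji, hj⟩, q, rfl⟩) | ⟨q, rfl⟩⟩
    · exact ⟨(⟨i, hi⟩, q, none), rfl⟩
    · refine ⟨(⟨i, hi⟩, q, some ⟨j, hj⟩), ?_⟩
      simp [witnessPoint, witnessRadius, witnessTilt, attachIndex, hji]
    · refine ⟨(⟨i, hi⟩, q, some ⟨i, hi⟩), ?_⟩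
      simp [witnessPoint, witnessRadius, witnessTilt, attachIndex]
  · rintro ⟨⟨i, q, _ | j⟩, rfl⟩
    · exact ⟨i, i.2, Or.inl (Or.inl ⟨q, rfl⟩)⟩
    · by_cases hji : j = i
      · subst hji
        refine ⟨j, j.2, Or.inr ⟨q, ?_⟩⟩
        simp [witnessPoint, witnessRadius, witnessTilt, attachIndex]
      · refine ⟨i, i.2, Or.inl (Or.inr ⟨j, ⟨fun h => hji (Fin.ext h), j.2⟩, q, ?_⟩)⟩
        have : (j : ℕ) ≠ i := fun h => hji (Fin.ext h)
        simp [witnessPoint, witnessRadius, witnessTilt, attachIndex, hji, this]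

theorem scaleB_eq (n j : ℕ) :
    scaleB n j = n - n * (1 / (n : ℝ) ^ 2) + j * (1 / (n : ℝ) ^ 2) := by
  unfold scaleB
  ring

theorem witness_epsilon_bounds (hn : 2 ≤ n) :
    0 < 1 / (n : ℝ) ^ 2 ∧ n * (1 / (n : ℝ) ^ 2) ≤ 1 / 2 ∧ (2 : ℝ) ≤ n := by
  have h : (2 : ℝ) ≤ n := by exact_mod_cast hn
  refine ⟨by positivity, ?_, h⟩
  rw [mul_one_div, div_le_div_iff₀ (by positivity) (by norm_num)]
  nlinarith

theorem scaleB_le_scaleB_iff (hn : 2 ≤ n) {i j : ℕ} : scaleB n i ≤ scaleB n j ↔ i ≤ j := by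
  rw [scaleB_eq, scaleB_eq, add_le_add_iff_left,
    mul_le_mul_iff_left₀ (witness_epsilon_bounds hn).1, Nat.cast_le]

theorem scaleB_injective (hn : 2 ≤ n) : Function.Injective (scaleB n) := fun _ _ h =>
  le_antisymm ((scaleB_le_scaleB_iff hn).mp h.le) ((scaleB_le_scaleB_iff hn).mp h.ge)

theorem three_halves_le_scaleB (hn : 2 ≤ n) (j : ℕ) : 3 / 2 ≤ scaleB n j := by
  obtain ⟨h1, h2, h3⟩ := witness_epsilon_bounds hn
  rw [scaleB_eq]
  have : 0 ≤ (j : ℝ) * (1 / (n : ℝ) ^ 2) := by positivity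
  linarith

/-- The last scale is less than the distance of opposite points of an inner square. -/
theorem scaleB_lt_two_mul (hn : 2 ≤ n) {j : ℕ} (hj : j ≤ n + 1) :
    scaleB n j < 2 * scaleB n 0 := by
  obtain ⟨h1, h2, h3⟩ := witness_epsilon_bounds hn
  refine ((scaleB_le_scaleB_iff hn).mpr hj).trans_lt ?_
  rw [scaleB_eq, scaleB_eq]
  push_cast
  nlinarith

/-- The extreme difference is `(n + 1) ε`. This bounds the radial width of a cluster, well below the
smallest scale, which is at least `3 / 2`. -/
theorem scaleB_sub_le (hn : 2 ≤ n) {i j : ℕ} (hi : i ≤ n + 1) : scaleB n i - scaleB n j ≤ 1 := by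
  obtain ⟨h1, h2, h3⟩ := witness_epsilon_bounds hn
  have := (scaleB_le_scaleB_iff hn).mpr hi
  have := (scaleB_le_scaleB_iff hn).mpr (Nat.zero_le j)
  rw [scaleB_eq n (n + 1)] at *
  rw [scaleB_eq n 0] at *
  push_cast at *
  nlinarith

/-- Together with `scaleB_lt_two_mul` this keeps outer points from being adjacent to points in
another direction. -/
theorem witnessRadius_bounds (hn : 2 ≤ n) (i : Fin (n + 1)) (j : Fin (n + 1)) :
    2 * scaleB n 0 ≤ witnessRadius i (some j) := by
  have := (scaleB_le_scaleB_iff hn).mpr (Nat.zero_le (attachIndex i j))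
  simp only [witnessRadius]
  linarith

theorem witnessTilt_bounds (hn : 2 ≤ n) (i : Fin (n + 1)) (m : Option (Fin (n + 1))) :
    0 ≤ witnessTilt i m ∧ witnessTilt i m ≤ 1 := by
  obtain ⟨h1, h2, h3⟩ := witness_epsilon_bounds hn
  rcases m with _ | j
  · simp [witnessTilt]
  simp only [witnessTilt]
  split_ifs
  · have e0 := three_halves_le_scaleB hn 0
    have e1 := three_halves_le_scaleB hn (i + 1)
    refine ⟨by positivity, ?_⟩
    have h : scaleB n 0 + scaleB n (i + 1) ≤ 2 * n := by
      have := (scaleB_le_scaleB_iff hn).mpr (Nat.succ_le_succ (Nat.lt_succ_iff.mp i.2))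
      refine (add_le_add_right this _).trans ?_
      rw [scaleB_eq, scaleB_eq]
      push_cast
      nlinarith
    calc _ ≤ 2 * (n : ℝ) * (1 / (n : ℝ) ^ 2) := mul_le_mul_of_nonneg_right h h1.le
      _ ≤ 1 := by linarith
  · simp

/-- The spacing `n + ε` of the layers equals the last scale, so exactly the consecutive layers meet,
and only then. -/
theorem abs_height_le_iff (hn : 2 ≤ n) {s : ℕ} (hs : s ≤ n + 1) (i i' : Fin (n + 1)) :
    |((n : ℝ) + 1 / (n : ℝ) ^ 2) * (i : ℕ) - (n + 1 / (n : ℝ) ^ 2) * (i' : ℕ)| ≤ scaleB n s ↔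
      layerAdj s i i' := by
  have hB : (n : ℝ) + 1 / (n : ℝ) ^ 2 = scaleB n (n + 1) := by
    rw [scaleB_eq]
    push_cast
    ring
  have hs' := (scaleB_le_scaleB_iff hn).mpr hs
  have hpos := three_halves_le_scaleB hn s
  rw [hB, ← mul_sub, abs_mul, abs_of_pos (by linarith : 0 < scaleB n (n + 1))]
  constructor
  · intro h
    by_cases hii : i = i'
    · exact Or.inl hii
    have hz : (1 : ℤ) ≤ |(i : ℤ) - (i' : ℤ)| := by
      refine Int.one_le_abs (sub_ne_zero.mpr fun h => hii (Fin.ext ?_))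
      exact_mod_cast h
    have h1 : (1 : ℝ) ≤ |((i : ℕ) : ℝ) - ((i' : ℕ) : ℝ)| := by exact_mod_cast hz
    have hss : n + 1 ≤ s := (scaleB_le_scaleB_iff hn).mp (by nlinarith)
    have h2 : |((i : ℕ) : ℝ) - ((i' : ℕ) : ℝ)| < 2 := by nlinarith
    have hz2 : |(i : ℤ) - (i' : ℤ)| < 2 := by exact_mod_cast h2
    rw [abs_lt] at hz2
    have hne : (i : ℕ) ≠ i' := fun h => hii (Fin.ext h)
    exact Or.inr ⟨by omega, by omega⟩
  · rintro (rfl | ⟨rfl, h | h⟩)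
    · rw [sub_self, abs_zero, mul_zero]
      linarith
    · rw [← h]
      push_cast
      simp
    · rw [← h]
      push_cast
      simp

/-- Distances in the witness at the relevant scales. -/
theorem dist_witnessPoint_le_iff (hn : 2 ≤ n) {s : ℕ} (hs : s ≤ n + 1) (u v : WitnessIndex n) :
    dist (witnessPoint u) (witnessPoint v) ≤ scaleB n s ↔ witnessAdj s u v := by
  obtain ⟨i, q, m⟩ := u
  obtain ⟨i', q', m'⟩ := v
  have hr := three_halves_le_scaleB hn s
  have hr' : 0 ≤ scaleB n s := by linarith
  have h0 := three_halves_le_scaleB hn 0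
  have h0s := (scaleB_le_scaleB_iff hn).mpr (Nat.zero_le s)
  have hlt := scaleB_lt_two_mul hn hs
  obtain ⟨hτ, hτ1⟩ := witnessTilt_bounds hn i m
  obtain ⟨hτ', hτ1'⟩ := witnessTilt_bounds hn i' m'
  have hneg : ∀ {x : ℝ}, 2 * scaleB n 0 ≤ x → ¬ |x| ≤ scaleB n s := fun h h' => by
    linarith [le_abs_self ‹ℝ›, (abs_le.mp h').2]
  -- A quarter turn apart, only two inner points can be close.
  have hnext : ∀ (i i' : Fin (n + 1)) (m m' : Option (Fin (n + 1))),
      (|witnessRadius i m + witnessTilt i' m'| ≤ scaleB n s ∧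
        |witnessRadius i' m' - witnessTilt i m| ≤ scaleB n s) ↔ m = none ∧ m' = none := by
    intro i i' m m'
    obtain ⟨hτ', hτ1'⟩ := witnessTilt_bounds hn i' m'
    rcases m with _ | j
    · rcases m' with _ | j'
      · simp only [witnessRadius, witnessTilt, add_zero, sub_zero, and_self, iff_true]
        rwa [abs_of_pos (by linarith)]
      · have := witnessRadius_bounds hn i' j'
        have h2 : witnessTilt i none = 0 := rfl
        simp only [h2, sub_zero, hneg this, and_false, reduceCtorEq]
    · have := witnessRadius_bounds hn i j
      simp only [hneg (this.trans (le_add_of_nonneg_right hτ')), false_and, reduceCtorEq]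
  have hcases : q' = q ∨ q' = q + 1 ∨ q' = q + 2 ∨ q = q' + 1 := by
    clear * -
    revert q q'
    decide
  have hne1 : ∀ q : Fin 4, q + 1 ≠ q ∧ q ≠ q + 1 ∧ q + 1 ≠ q + 2 ∧ q ≠ q + 1 + 2 ∧ q + 2 ≠ q := by
    decide
  rcases hcases with rfl | rfl | rfl | rfl
  · refine (dist_dirPoint_same hr' q').trans ?_
    rw [abs_height_le_iff hn hs, and_comm]
    refine and_congr_right fun _ => ?_
    rcases m with _ | j <;> rcases m' with _ | j'
    · refine iff_of_true ?_ (ne_add_two q')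
      simp [witnessRadius, witnessTilt, hr']
    · change _ ↔ q' = q' ∧ attachIndex i' j' ≤ s
      rw [← scaleB_le_scaleB_iff hn]
      have hb := three_halves_le_scaleB hn (attachIndex i' j')
      have h2 : witnessTilt i none = 0 := rfl
      have h3 : |witnessTilt i none - witnessTilt i' (some j')| ≤ scaleB n s := by
        rw [h2, zero_sub, abs_neg, abs_of_nonneg hτ']
        linarith
      simp only [h3, and_true, true_and]
      simp only [witnessRadius, sub_add_cancel_left, abs_neg]
      rw [abs_of_pos (by linarith)]
    · change _ ↔ q' = q' ∧ attachIndex i j ≤ s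
      rw [← scaleB_le_scaleB_iff hn]
      have hb := three_halves_le_scaleB hn (attachIndex i j)
      have h2 : witnessTilt i' none = 0 := rfl
      have h3 : |witnessTilt i (some j) - witnessTilt i' none| ≤ scaleB n s := by
        rw [h2, sub_zero, abs_of_nonneg hτ]
        linarith
      simp only [h3, and_true, true_and]
      simp only [witnessRadius, add_sub_cancel_left]
      rw [abs_of_pos (by linarith)]
    · refine iff_of_true ⟨?_, ?_⟩ rfl
      · simp only [witnessRadius, add_sub_add_left_eq_sub, abs_le]
        have e1 := scaleB_sub_le hn (j := attachIndex i' j')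
          (attachIndex_le (i := i) (Nat.lt_succ_iff.mp j.2))
        have e2 := scaleB_sub_le hn (j := attachIndex i j)
          (attachIndex_le (i := i') (Nat.lt_succ_iff.mp j'.2))
        constructor <;> linarith
      · rw [abs_le]
        constructor <;> linarith
  · refine (dist_dirPoint_next hr' q).trans ?_
    rw [abs_height_le_iff hn hs, and_comm, hnext]
    refine and_congr_right fun _ => ?_
    rcases m with _ | j <;> rcases m' with _ | j' <;> simp [slotAdj, hne1 q]
  · refine (dist_dirPoint_opposite hr' q).trans ?_
    refine iff_of_false ?_ fun h => h.dir_ne rfl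
    rintro ⟨⟨h, -⟩, -⟩
    have hrad : ∀ (i : Fin (n + 1)) m, scaleB n 0 ≤ witnessRadius i m := by
      intro i m
      rcases m with _ | j
      · exact le_rfl
      · linarith [witnessRadius_bounds hn i j]
    exact hneg (by linarith [hrad i m, hrad i' m']) h
  · rw [dist_comm]
    refine (dist_dirPoint_next hr' q').trans ?_
    rw [abs_height_le_iff hn hs, and_comm, hnext]
    refine (and_congr_left' ⟨layerAdj.symm, layerAdj.symm⟩).trans ?_
    refine and_congr_right fun _ => ?_
    rcases m with _ | j <;> rcases m' with _ | j' <;> simp [slotAdj, hne1 q']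

theorem witnessPoint_injective (hn : 2 ≤ n) :
    Function.Injective (witnessPoint : WitnessIndex n → Fin 3 → ℝ) := by
  rintro ⟨i, q, m⟩ ⟨i', q', m'⟩ h
  have hd : dist (witnessPoint (i, q, m)) (witnessPoint (i', q', m')) ≤ 0 := by rw [h, dist_self]
  have h0 := three_halves_le_scaleB hn 0
  have hrad : ∀ (i : Fin (n + 1)) m, scaleB n 0 ≤ witnessRadius i m := by
    intro i m
    rcases m with _ | j
    · exact le_rfl
    · linarith [witnessRadius_bounds hn i j]
  have hcases : q' = q ∨ q' = q + 1 ∨ q' = q + 2 ∨ q = q' + 1 := by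
    clear * -
    revert q q'
    decide
  rcases hcases with rfl | rfl | rfl | rfl
  · obtain ⟨⟨h1, h2⟩, h3⟩ := (dist_dirPoint_same le_rfl q').mp hd
    rw [abs_nonpos_iff, sub_eq_zero] at h1 h2 h3
    have hpos : (0 : ℝ) < n + 1 / (n : ℝ) ^ 2 := by
      obtain ⟨e1, e2, e3⟩ := witness_epsilon_bounds hn
      linarith
    obtain rfl : i = i' := Fin.ext (by exact_mod_cast mul_left_cancel₀ hpos.ne' h3)
    rcases m with _ | j <;> rcases m' with _ | j'
    · rfl
    · linarith [witnessRadius_bounds hn i j', show witnessRadius i none = scaleB n 0 from rfl]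
    · linarith [witnessRadius_bounds hn i j, show witnessRadius i none = scaleB n 0 from rfl]
    · have hatt := scaleB_injective hn (add_left_cancel h1)
      have htilt : 0 < (scaleB n 0 + scaleB n (i + 1)) * (1 / (n : ℝ) ^ 2) :=
        mul_pos (by linarith [three_halves_le_scaleB hn (i + 1)]) (witness_epsilon_bounds hn).1
      simp only [witnessTilt] at h2
      -- In layer `i` the slots `i` and `i + 1` have the same radius; the positive tilt of slot `i`
      -- separates them.
      have : j = j' := by
        by_cases hj : j = i <;> by_cases hj' : j' = i
        · exact hj.trans hj'.symm
        · rw [if_pos hj, if_neg hj'] at h2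
          exact absurd h2 htilt.ne'
        · rw [if_neg hj, if_pos hj'] at h2
          exact absurd h2.symm htilt.ne'
        · rw [attachIndex, attachIndex, if_neg fun h => hj (Fin.ext h),
            if_neg fun h => hj' (Fin.ext h)] at hatt
          exact Fin.ext hatt
      rw [this]
  · have h1 := ((dist_dirPoint_next le_rfl q).mp hd).1.1
    rw [abs_nonpos_iff] at h1
    linarith [hrad i m, (witnessTilt_bounds hn i' m').1]
  · have h1 := ((dist_dirPoint_opposite le_rfl q).mp hd).1.1
    rw [abs_nonpos_iff] at h1
    linarith [hrad i m, hrad i' m']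
  · rw [dist_comm] at hd
    have h1 := ((dist_dirPoint_next le_rfl q').mp hd).1.1
    rw [abs_nonpos_iff] at h1
    linarith [hrad i' m', (witnessTilt_bounds hn i m).1]

/-- The labelling of the points of the witness. -/
noncomputable def witnessEquiv (hn : 2 ≤ n) : WitnessIndex n ≃ witnessSet n :=
  Equiv.ofBijective (fun u => ⟨witnessPoint u, mem_witnessSet_iff.mpr ⟨u, rfl⟩⟩)
    ⟨fun u v h => witnessPoint_injective hn (congrArg Subtype.val h), fun p => by
      obtain ⟨u, hu⟩ := mem_witnessSet_iff.mp p.2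
      exact ⟨u, Subtype.ext hu⟩⟩

theorem card_witnessSet (hn : 2 ≤ n) : (witnessSet n).card = 4 * (n + 1) * (n + 2) := by
  rw [← Fintype.card_coe, ← Fintype.card_congr (witnessEquiv hn)]
  simp only [Fintype.card_prod, Fintype.card_fin, Fintype.card_option]
  ring

theorem dist_witnessEquiv_le_iff (hn : 2 ≤ n) {s : ℕ} (hs : s ≤ n + 1) (u v : WitnessIndex n) :
    dist (witnessEquiv hn u) (witnessEquiv hn v) ≤ scaleB n s ↔ witnessAdj s u v :=
  dist_witnessPoint_le_iff hn hs u v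

end WitnessGeometry

/-! ### The homology of the witness -/

section RipsComplexes

theorem complexNeighbors_ripsFiltration {X : Type*} [MetricSpace X] (r : ℝ≥0) (x : X) :
    complexNeighbors (ripsFiltration X r) x = {y | y ≠ x ∧ dist x y ≤ r} := by
  classical
  ext y
  refine and_congr_right fun _ => ⟨?_, fun h => ⟨{x, y}, ⟨by simp, ?_⟩, by simp⟩⟩
  · rintro ⟨σ, hσ, e⟩
    have hx : x ∈ (σ : Set X) := by rw [e]; simp
    have hy : y ∈ (σ : Set X) := by rw [e]; simp
    exact hσ.2 x hx y hy
  · intro a ha b hb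
    rw [Finset.mem_insert, Finset.mem_singleton] at ha hb
    rcases ha with rfl | rfl <;> rcases hb with rfl | rfl
    · simp
    · exact h
    · rwa [dist_comm]
    · simp

theorem spansSimplex_degreeRips_iff {X : Type*} [MetricSpace X] [Finite X] {p : ℤᵒᵈ × ℝ≥0} {m : ℕ}
    {t : Fin (m + 1) → X} : SpansSimplex (degreeRips X p) t ↔
      (∀ a b, dist (t a) (t b) ≤ p.2) ∧
        ∀ a, OrderDual.ofDual p.1 - 1 ≤ ({y | y ≠ t a ∧ dist (t a) y ≤ p.2}.ncard : ℤ) := by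
  classical
  have key : ∀ σ : Finset X, σ ∈ degreeRips X p ↔ (σ.Nonempty ∧ ∀ x ∈ σ, ∀ y ∈ σ, dist x y ≤ p.2) ∧
      ∀ x ∈ σ, OrderDual.ofDual p.1 - 1 ≤ ({y | y ≠ x ∧ dist x y ≤ p.2}.ncard : ℤ) := by
    intro σ
    simp only [← complexNeighbors_ripsFiltration]
    exact Iff.rfl
  constructor
  · rintro ⟨σ, hσ, e⟩
    have hmem : ∀ a, t a ∈ σ := fun a => by
      have : t a ∈ (σ : Set X) := by rw [e]; exact ⟨a, rfl⟩
      exact this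
    have hσ' := (key σ).mp hσ
    exact ⟨fun a b => hσ'.1.2 _ (hmem a) _ (hmem b), fun a => hσ'.2 _ (hmem a)⟩
  · rintro ⟨h1, h2⟩
    refine ⟨Finset.univ.image t, (key _).mpr ⟨⟨⟨t 0, by simp⟩, ?_⟩, ?_⟩, by simp⟩
    · simpa using h1
    · simpa using h2

end RipsComplexes

section WitnessHomology

variable {n : ℕ}

/-- The degree condition on a point of the witness at the point `p` of the subgrid. -/
def witnessPresent (p : Fin (n + 2) × Fin (n + 2)) (u : WitnessIndex n) : Prop :=
  (n : ℤ) + 3 - (p.1 : ℕ) ≤ ({v | v ≠ u ∧ witnessAdj (p.2 : ℕ) u v}.ncard : ℤ)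

/-- The degree-Rips complexes of the witness over the subgrid. -/
noncomputable def witnessFiltration (n : ℕ) :
    Fin (n + 2) × Fin (n + 2) →o PreAbstractSimplicialComplex (witnessSet n) :=
  (degreeRips (witnessSet n)).comp (subgrid n 1)

/-- This replaces the geometry by the flag complex of `witnessAdj` on the vertices of sufficient
degree. -/
theorem spansSimplex_witness_iff (hn : 2 ≤ n) (p : Fin (n + 2) × Fin (n + 2)) {m : ℕ}
    {t : Fin (m + 1) → witnessSet n} : SpansSimplex (witnessFiltration n p) t ↔
      (∀ a b, witnessAdj (p.2 : ℕ) ((witnessEquiv hn).symm (t a)) ((witnessEquiv hn).symm (t b))) ∧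
        ∀ a, witnessPresent p ((witnessEquiv hn).symm (t a)) := by
  have hs : (p.2 : ℕ) ≤ n + 1 := Nat.lt_succ_iff.mp p.2.2
  have hr : (((subgrid n 1 p).2 : ℝ≥0) : ℝ) = scaleB n p.2 := by
    change ((1 * (scaleB n p.2).toNNReal : ℝ≥0) : ℝ) = _
    rw [one_mul, Real.coe_toNNReal _ (by linarith [three_halves_le_scaleB hn p.2])]
  have hdist : ∀ x y : witnessSet n, dist x y ≤ scaleB n p.2 ↔
      witnessAdj (p.2 : ℕ) ((witnessEquiv hn).symm x) ((witnessEquiv hn).symm y) := fun x y => by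
    rw [← dist_witnessEquiv_le_iff hn hs, Equiv.apply_symm_apply, Equiv.apply_symm_apply]
  refine spansSimplex_degreeRips_iff.trans ?_
  rw [hr]
  refine and_congr (forall₂_congr fun a b => hdist _ _) (forall_congr' fun a => ?_)
  have hset : {y | y ≠ t a ∧ dist (t a) y ≤ scaleB n p.2} = witnessEquiv hn ''
      {v | v ≠ (witnessEquiv hn).symm (t a) ∧
        witnessAdj (p.2 : ℕ) ((witnessEquiv hn).symm (t a)) v} := by
    ext y
    rw [Equiv.image_eq_preimage_symm]
    simp [hdist]
  rw [hset, Set.ncard_image_of_injective _ (witnessEquiv hn).injective, witnessPresent]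
  change (n : ℤ) + 4 - (p.1 : ℕ) - 1 ≤ _ ↔ _
  rw [show (n : ℤ) + 4 - (p.1 : ℕ) - 1 = n + 3 - (p.1 : ℕ) by ring]

/-! #### Degrees of the points of the inner squares -/

/-- Slot `i` attaches one scale late, so the count is one short at `s = i` and has caught up at `i +
1`. -/
theorem ncard_attachIndex_le (i : Fin (n + 1)) {s : ℕ} (hs : s ≤ n) :
    {j : Fin (n + 1) | attachIndex i j ≤ s}.ncard = if s = i then s else s + 1 := by
  split_ifs with h
  · have : {j : Fin (n + 1) | attachIndex i j ≤ s} = ↑(Finset.Iio i) := by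
      ext j
      simp only [attachIndex, Set.mem_ofPred_eq, Finset.coe_Iio, Set.mem_Iio, Fin.lt_def]
      split_ifs <;> omega
    rw [this, Set.ncard_coe_finset, Fin.card_Iio, h]
  · have : {j : Fin (n + 1) | attachIndex i j ≤ s} =
        ↑(Finset.Iic (⟨s, Nat.lt_succ_of_le hs⟩ : Fin (n + 1))) := by
      ext j
      simp only [attachIndex, Set.mem_ofPred_eq, Finset.coe_Iic, Set.mem_Iic, Fin.le_def]
      split_ifs <;> omega
    rw [this, Set.ncard_coe_finset, Fin.card_Iic]

/-- The neighbours of a point of an inner square inside its layer. -/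
def squareNeighbors (s : ℕ) (i : Fin (n + 1)) (q : Fin 4) : Set (WitnessIndex n) :=
  {(i, q + 1, none), (i, q + 3, none)} ∪
    (fun j : Fin (n + 1) => (i, q, some j)) '' {j | attachIndex i j ≤ s}

theorem ncard_squareNeighbors (s : ℕ) (i : Fin (n + 1)) (q : Fin 4) :
    (squareNeighbors s i q).ncard = 2 + {j : Fin (n + 1) | attachIndex i j ≤ s}.ncard := by
  rw [squareNeighbors, Set.ncard_union_eq, Set.ncard_pair, Set.ncard_image_of_injective]
  · intro j j' h
    simpa using h
  · have : ∀ q : Fin 4, q + 1 ≠ q + 3 := by decide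
    simp [this q]
  · rw [Set.disjoint_left]
    rintro _ (rfl | rfl) ⟨j, -, h⟩ <;> simp at h

theorem squareNeighbors_subset (s : ℕ) (i : Fin (n + 1)) (q : Fin 4) :
    squareNeighbors s i q ⊆ {v | v ≠ (i, q, none) ∧ witnessAdj s (i, q, none) v} := by
  have h : ∀ q : Fin 4, q + 1 ≠ q ∧ q + 1 ≠ q + 2 ∧ q + 3 ≠ q ∧ q + 3 ≠ q + 2 := by decide
  rintro _ ((rfl | rfl) | ⟨j, hj, rfl⟩)
  · exact ⟨by simp [(h q).1], Or.inl rfl, (h q).2.1⟩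
  · exact ⟨by simp [(h q).2.2.1], Or.inl rfl, (h q).2.2.2⟩
  · exact ⟨by simp, Or.inl rfl, rfl, hj⟩

theorem squareNeighbors_eq {s : ℕ} (hs : s ≤ n) (i : Fin (n + 1)) (q : Fin 4) :
    {v | v ≠ (i, q, none) ∧ witnessAdj s (i, q, none) v} = squareNeighbors s i q := by
  refine (squareNeighbors_subset s i q).antisymm' ?_
  rintro ⟨i', q', m⟩ ⟨hne, h⟩
  obtain rfl : i = i' := h.1.eq hs
  rcases m with _ | j
  · have h2 : q' ≠ q + 2 := h.2
    have hne' : q' ≠ q := fun h => hne (by rw [h])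
    have : q' = q + 1 ∨ q' = q + 3 := by
      clear * - h2 hne'
      revert q q'
      decide
    rcases this with rfl | rfl
    · exact Or.inl (Or.inl rfl)
    · exact Or.inl (Or.inr rfl)
  · obtain ⟨rfl, ha⟩ : q = q' ∧ _ := h.2
    exact Or.inr ⟨j, ha, rfl⟩

/-- The degree is two square neighbours plus `s + 1` attached points, less one when `s = i`, where
`s = p.2`. The threshold `n + 3 - p.1` is thus missed on the antidiagonal only by layer `p.2`. -/
theorem witnessPresent_square_iff {p : Fin (n + 2) × Fin (n + 2)} (hp : (p.2 : ℕ) ≤ n)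
    (i : Fin (n + 1)) (q : Fin 4) : witnessPresent p (i, q, none) ↔
      n < (p.1 : ℕ) + p.2 ∨ ((p.1 : ℕ) + p.2 = n ∧ (p.2 : ℕ) ≠ i) := by
  rw [witnessPresent, squareNeighbors_eq hp, ncard_squareNeighbors, ncard_attachIndex_le i hp]
  split_ifs <;> push_cast <;> omega

theorem witnessPresent_square_of_eq {p : Fin (n + 2) × Fin (n + 2)} (hp : (p.2 : ℕ) = n + 1)
    (i : Fin (n + 1)) (q : Fin 4) : witnessPresent p (i, q, none) := by
  have h1 := Set.ncard_le_ncard (squareNeighbors_subset (p.2 : ℕ) i q) (Set.toFinite _)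
  have h2 : {j : Fin (n + 1) | attachIndex i j ≤ p.2} = Set.univ :=
    Set.eq_univ_of_forall fun j => by
      rw [hp]
      exact attachIndex_le (Nat.lt_succ_iff.mp j.2)
  rw [ncard_squareNeighbors, h2, Set.ncard_univ, Nat.card_eq_fintype_card, Fintype.card_fin] at h1
  rw [witnessPresent]
  omega

/-! #### The cocycles of the witness -/

variable {F : Type*} [Field F]

/-- The pullback of the cocycle of the `4`-cycle of directions. -/
noncomputable def directionCocycle (F : Type*) [Field F] (hn : 2 ≤ n) (x y : witnessSet n) : F :=
  squareCocycle F ((witnessEquiv hn).symm x).2.1 ((witnessEquiv hn).symm y).2.1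

/-- The part of `directionCocycle` which lies in a given layer. -/
noncomputable def layerCocycle (F : Type*) [Field F] (hn : 2 ≤ n) (i : Fin (n + 1))
    (x y : witnessSet n) : F :=
  if ((witnessEquiv hn).symm x).1 = i then directionCocycle F hn x y else 0

theorem sum_layerCocycle (hn : 2 ≤ n) (c : Fin (n + 1) → F) (x y : witnessSet n) :
    ∑ i, c i * layerCocycle F hn i x y =
      c ((witnessEquiv hn).symm x).1 * directionCocycle F hn x y := by
  simp [layerCocycle]

theorem isCocycle_directionCocycle (hn : 2 ≤ n) (p : Fin (n + 2) × Fin (n + 2)) :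
    IsCocycle (witnessFiltration n p) (directionCocycle F hn) := by
  intro a b c h
  have h' := ((spansSimplex_witness_iff hn p).mp h).1
  exact squareCocycle_add (h' 0 1).dir_ne (h' 1 2).dir_ne (h' 0 2).dir_ne

/-- Below the last scale no simplex meets two layers, so a cocycle may be cut off to one layer. -/
theorem isCocycle_layerCocycle (hn : 2 ≤ n) {p : Fin (n + 2) × Fin (n + 2)} (hp : (p.2 : ℕ) ≤ n)
    (i : Fin (n + 1)) : IsCocycle (witnessFiltration n p) (layerCocycle F hn i) := by
  intro a b c h
  have h' := ((spansSimplex_witness_iff hn p).mp h).1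
  have hab : ((witnessEquiv hn).symm a).1 = ((witnessEquiv hn).symm b).1 := (h' 0 1).1.eq hp
  have hd := isCocycle_directionCocycle (F := F) hn p a b c h
  simp only [layerCocycle, ← hab]
  split_ifs
  · exact hd
  · exact add_zero 0

theorem IsCocycle.isWitnessCocycle (hn : 2 ≤ n) {p : Fin (n + 2) × Fin (n + 2)}
    {f : witnessSet n → witnessSet n → F} (hf : IsCocycle (witnessFiltration n p) f) :
    IsWitnessCocycle (p.2 : ℕ) (witnessPresent p)
      fun u v => f (witnessEquiv hn u) (witnessEquiv hn v) := by
  intro u v w hu hv hw huv hvw huw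
  refine hf _ _ _ ((spansSimplex_witness_iff hn p).mpr ⟨?_, ?_⟩)
  · intro a b
    fin_cases a <;> fin_cases b <;>
      simp [huv, hvw, huw, huv.symm, hvw.symm, huw.symm, witnessAdj_refl]
  · intro a
    fin_cases a <;> simp [hu, hv, hw]

theorem cocycleEval_eq_zero_of_edges {V : Type*} {K : PreAbstractSimplicialComplex V}
    {f : V → V → F} (h : ∀ a b, SpansSimplex K ![a, b] → f a b = 0)
    (x : SimplicialHomology F K 1) : cocycleEval K f x = 0 := by
  by_cases hf : IsCocycle K f
  · obtain ⟨x, rfl⟩ := Submodule.Quotient.mk_surjective _ x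
    rw [hf.cocycleEval_mk, edgeEval_congr (f' := fun _ _ => 0) h x.2.1]
    simp [edgeEval, Finsupp.linearCombination_apply]
  · rw [cocycleEval, dif_neg hf, LinearMap.zero_apply]

/-- Without its inner points, a layer only has edges that preserve the direction, and the square
cocycle vanishes on those. -/
theorem cocycleEval_layerCocycle_eq_zero (hn : 2 ≤ n) {p : Fin (n + 2) × Fin (n + 2)}
    (i : Fin (n + 1)) (hpres : ∀ q, ¬ witnessPresent p (i, q, none))
    (x : SimplicialHomology F (witnessFiltration n p) 1) :
    cocycleEval (witnessFiltration n p) (layerCocycle F hn i) x = 0 := by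
  refine cocycleEval_eq_zero_of_edges (fun a b h => ?_) x
  obtain ⟨h1, h2⟩ := (spansSimplex_witness_iff hn p).mp h
  have hab : witnessAdj (p.2 : ℕ) ((witnessEquiv hn).symm a) ((witnessEquiv hn).symm b) := h1 0 1
  have ha : witnessPresent p ((witnessEquiv hn).symm a) := h2 0
  rw [layerCocycle, directionCocycle]
  generalize (witnessEquiv hn).symm a = u at *
  generalize (witnessEquiv hn).symm b = v at *
  obtain ⟨k, q, m⟩ := u
  obtain ⟨k', q', m'⟩ := v
  split_ifs with hki
  · obtain rfl : k = i := hki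
    have h3 := hab.2
    rcases m with _ | j
    · exact absurd ha (hpres q)
    · have : q = q' := by
        rcases m' with _ | j'
        exacts [h3.1, h3]
      rw [this, squareCocycle_self]
  · rfl

theorem eq_zero_of_layerCocycles (hn : 2 ≤ n) {p : Fin (n + 2) × Fin (n + 2)} (hp : (p.2 : ℕ) ≤ n)
    (x : SimplicialHomology F (witnessFiltration n p) 1)
    (hx : ∀ i, cocycleEval (witnessFiltration n p) (layerCocycle F hn i) x = 0) : x = 0 := by
  refine eq_zero_of_cocycleEval_eq_zero _ (isCocycle_layerCocycle hn hp) (fun f hf => ?_) x hx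
  obtain ⟨c, g, hcg⟩ := (hf.isWitnessCocycle hn).exists_potential_of_le hp
  refine ⟨c, fun x => g ((witnessEquiv hn).symm x), fun a b hab => ?_⟩
  obtain ⟨h1, h2⟩ := (spansSimplex_witness_iff hn p).mp hab
  rw [sum_layerCocycle]
  simpa [directionCocycle] using hcg _ _ (h2 0) (h2 1) (h1 0 1)

theorem eq_zero_of_directionCocycle (hn : 2 ≤ n) {p : Fin (n + 2) × Fin (n + 2)}
    (hp : (p.2 : ℕ) = n + 1) (x : SimplicialHomology F (witnessFiltration n p) 1)
    (hx : cocycleEval (witnessFiltration n p) (directionCocycle F hn) x = 0) : x = 0 := by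
  refine eq_zero_of_cocycleEval_eq_zero (fun _ : Unit => directionCocycle F hn)
    (fun _ => isCocycle_directionCocycle hn p) (fun f hf => ?_) x fun _ => hx
  have hf' := hf.isWitnessCocycle hn
  rw [hp] at hf'
  obtain ⟨c, g, hcg⟩ := hf'.exists_potential_of_eq fun i q => witnessPresent_square_of_eq hp i q
  refine ⟨fun _ => c, fun x => g ((witnessEquiv hn).symm x), fun a b hab => ?_⟩
  obtain ⟨h1, h2⟩ := (spansSimplex_witness_iff hn p).mp hab
  rw [hp] at h1
  simpa [directionCocycle] using hcg _ _ (h2 0) (h2 1) (h1 0 1)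

theorem sum_squareCocycle : ∑ q : Fin 4, squareCocycle F q (q + 1) = 1 := by
  simp [Fin.sum_univ_four, squareCocycle]

/-- The class of the inner square of a layer. -/
theorem exists_layer_class (hn : 2 ≤ n) {p : Fin (n + 2) × Fin (n + 2)} (i : Fin (n + 1))
    (hpres : ∀ q, witnessPresent p (i, q, none)) :
    ∃ x : SimplicialHomology F (witnessFiltration n p) 1,
      cocycleEval (witnessFiltration n p) (directionCocycle F hn) x = 1 ∧
      ((p.2 : ℕ) ≤ n → ∀ k, cocycleEval (witnessFiltration n p) (layerCocycle F hn k) x =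
        if i = k then 1 else 0) := by
  obtain ⟨x, hx⟩ := exists_square_class (F := F) (K := witnessFiltration n p)
    (fun q => witnessEquiv hn (i, q, none)) (fun q => by
      have hadj : witnessAdj (p.2 : ℕ) ((i, q, none) : WitnessIndex n) (i, q + 1, none) := by
        have : ∀ q : Fin 4, q + 1 ≠ q + 2 := by decide
        exact ⟨Or.inl rfl, this q⟩
      refine (spansSimplex_witness_iff hn p).mpr ⟨fun a b => ?_, fun a => ?_⟩
      · fin_cases a <;> fin_cases b <;> simp [hadj, hadj.symm, witnessAdj_refl]
      · fin_cases a <;> simp [hpres])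
  refine ⟨x, ?_, fun hp k => ?_⟩
  · rw [hx _ (isCocycle_directionCocycle hn p)]
    simp [directionCocycle, sum_squareCocycle]
  · rw [hx _ (isCocycle_layerCocycle hn hp k)]
    simp only [layerCocycle, directionCocycle, Equiv.symm_apply_apply]
    split_ifs
    · exact sum_squareCocycle
    · simp

theorem cocycleEval_directionCocycle_eq_sum (hn : 2 ≤ n) {p : Fin (n + 2) × Fin (n + 2)}
    (hp : (p.2 : ℕ) ≤ n) (x : SimplicialHomology F (witnessFiltration n p) 1) :
    cocycleEval (witnessFiltration n p) (directionCocycle F hn) x =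
      ∑ i, cocycleEval (witnessFiltration n p) (layerCocycle F hn i) x := by
  obtain ⟨x, rfl⟩ := Submodule.Quotient.mk_surjective _ x
  have h := fun i => (isCocycle_layerCocycle (F := F) hn hp i).cocycleEval_mk x
  rw [(isCocycle_directionCocycle hn p).cocycleEval_mk, Finset.sum_congr rfl fun i _ => h i,
    ← LinearMap.sum_apply]
  congr 1
  refine Finsupp.lhom_ext fun s c => ?_
  have := sum_layerCocycle (F := F) hn (fun _ => 1) (s 0) (s 1)
  simp only [one_mul] at this
  simp only [LinearMap.sum_apply, edgeEval_single]
  rw [← Finset.mul_sum, this]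

/-- The homology of the degree-Rips filtration of the witness over the subgrid. -/
theorem hasZigzagStructure_witnessFiltration (F : Type*) [Field F] (hn : 2 ≤ n) :
    HasZigzagStructure n (filtrationHomology F (witnessFiltration n) 1) := by
  -- On the antidiagonal the absent layer is `p.2 = n - p.1`, while the missing coordinate must be
  -- `p.1`; hence the reversal of the layers.
  let φ : ∀ p, SimplicialHomology F (witnessFiltration n p) 1 →ₗ[F] (Fin (n + 1) → F) := fun p =>
    LinearMap.pi fun k => cocycleEval (witnessFiltration n p) (layerCocycle F hn k.rev)
  let ψ : ∀ p, SimplicialHomology F (witnessFiltration n p) 1 →ₗ[F] F := fun p =>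
    cocycleEval (witnessFiltration n p) (directionCocycle F hn)
  have hψmap : ∀ (p q : Fin (n + 2) × Fin (n + 2)) (h : p ≤ q) x,
      ψ q (simplicialHomologyMap F ((witnessFiltration n).monotone h) 1 x) = ψ p x :=
    fun p q h x => (isCocycle_directionCocycle hn q).cocycleEval_map _ x
  refine ⟨φ, ψ, fun p hp => ⟨?_, fun v => ⟨?_, ?_⟩⟩, fun p hp => ⟨?_, ?_⟩, fun p q h hq x => ?_,
    fun p q h hp hq x => ?_, fun p q h hp x => hψmap p q h x⟩
  · refine (injective_iff_map_eq_zero (φ p)).mpr fun x hx => ?_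
    refine eq_zero_of_layerCocycles hn hp x fun i => ?_
    have := congrFun hx i.rev
    simpa [φ] using this
  · rintro ⟨x, rfl⟩
    have hzero : ∀ k : Fin (n + 1), ¬ (n < (p.1 : ℕ) + p.2 ∨
        ((p.1 : ℕ) + p.2 = n ∧ (p.2 : ℕ) ≠ k.rev)) → φ p x k = 0 := fun k hk =>
      cocycleEval_layerCocycle_eq_zero hn _
        (fun q => (witnessPresent_square_iff hp _ q).not.mpr hk) x
    refine ⟨fun h => funext fun k => hzero k (by omega), fun h k hk => hzero k ?_⟩
    rw [Fin.val_rev]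
    omega
  · rintro ⟨h1, h2⟩
    rw [← Finset.univ_sum_single v]
    refine Submodule.sum_mem _ fun k _ => ?_
    by_cases hk : v k = 0
    · rw [hk, Pi.single_zero]
      exact Submodule.zero_mem _
    have hpres : ∀ q, witnessPresent p (k.rev, q, none) := by
      refine fun q => (witnessPresent_square_iff hp _ q).mpr ?_
      rcases lt_trichotomy ((p.1 : ℕ) + p.2) n with h | h | h
      · exact absurd (congrFun (h1 h) k) hk
      · refine Or.inr ⟨h, fun h' => hk (h2 h k ?_)⟩
        rw [Fin.val_rev] at h'
        omega
      · exact Or.inl h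
    obtain ⟨x, -, hx⟩ := exists_layer_class (F := F) hn k.rev hpres
    refine ⟨v k • x, ?_⟩
    refine ((φ p).map_smul (v k) x).trans ?_
    funext l
    have hxl : φ p x l = if k.rev = l.rev then 1 else 0 := hx hp l.rev
    rw [Pi.smul_apply, hxl]
    by_cases hkl : k = l
    · simp [hkl]
    · simp [hkl, Ne.symm hkl]
  · exact (injective_iff_map_eq_zero (ψ p)).mpr fun x hx => eq_zero_of_directionCocycle hn hp x hx
  · intro c
    obtain ⟨x, hx, -⟩ := exists_layer_class (F := F) hn (0 : Fin (n + 1)) fun q =>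
      witnessPresent_square_of_eq hp 0 q
    refine ⟨c • x, ((ψ p).map_smul c x).trans ?_⟩
    have hx' : ψ p x = 1 := hx
    rw [hx', smul_eq_mul, mul_one]
  · funext k
    exact (isCocycle_layerCocycle hn hq k.rev).cocycleEval_map ((witnessFiltration n).monotone h) x
  · refine (hψmap p q h x).trans ((cocycleEval_directionCocycle_eq_sum hn hp x).trans ?_)
    exact (Equiv.sum_comp Fin.revPerm
      fun i => cocycleEval (witnessFiltration n p) (layerCocycle F hn i) x).symm

end WitnessHomology

/-! ### Čech complexes for the supremum metric -/

section Cech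

/-- Balls are boxes: a common point is found coordinate by coordinate, as the midpoint of the least
and greatest coordinate. -/
theorem biInter_closedBall_nonempty_iff {ι : Type*} [Fintype ι] {σ : Finset (ι → ℝ)} {r : ℝ}
    (hr : 0 ≤ r) (hσ : σ.Nonempty) : (⋂ x ∈ σ, Metric.closedBall x r).Nonempty ↔
      ∀ x ∈ σ, ∀ y ∈ σ, dist x y ≤ 2 * r := by
  constructor
  · rintro ⟨z, hz⟩ x hx y hy
    simp only [Set.mem_iInter, Metric.mem_closedBall] at hz
    linarith [dist_triangle_left x y z, hz x hx, hz y hy]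
  · intro h
    refine ⟨fun i => (σ.inf' hσ (fun x => x i) + σ.sup' hσ (fun x => x i)) / 2, ?_⟩
    simp only [Set.mem_iInter, Metric.mem_closedBall]
    intro x hx
    rw [dist_pi_le_iff hr]
    intro i
    obtain ⟨a, ha, hai⟩ := σ.exists_mem_eq_inf' hσ fun x => x i
    obtain ⟨b, hb, hbi⟩ := σ.exists_mem_eq_sup' hσ fun x => x i
    have h1 := σ.inf'_le (fun x => x i) hx
    have h2 := σ.le_sup' (fun x => x i) hx
    have h3 := (dist_le_pi_dist b a i).trans (h b hb a ha)
    rw [Real.dist_eq, abs_le] at h3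
    simp only [hai, hbi] at h1 h2 ⊢
    rw [Real.dist_eq, abs_le]
    constructor <;> linarith

/-- The doubling of the scale. -/
def doubleScale : ℝ≥0 →o ℝ≥0 where
  toFun r := 2 * r
  monotone' _ _ h := mul_le_mul_right h 2

theorem cechFiltration_eq_ripsFiltration (X : Finset (Fin 3 → ℝ)) :
    cechFiltration X = (ripsFiltration X).comp doubleScale := by
  classical
  refine OrderHom.ext _ _ (funext fun r => PreAbstractSimplicialComplex.ext (Set.ext fun σ => ?_))
  refine and_congr_right fun hσ => ?_
  have h := biInter_closedBall_nonempty_iff (σ := σ.image Subtype.val) r.2 (hσ.image _)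
  simp only [Finset.set_biInter_finset_image, Finset.forall_mem_image] at h
  exact h

theorem degreeCech_eq_degreeRips (X : Finset (Fin 3 → ℝ)) :
    degreeCech X = (degreeRips X).comp (OrderHom.id.prodMap doubleScale) := by
  rw [degreeCech, cechFiltration_eq_ripsFiltration]
  rfl

theorem degreeCech_comp_subgrid (n : ℕ) :
    (degreeCech (witnessSet n)).comp (subgrid n (1 / 2)) = witnessFiltration n := by
  rw [degreeCech_eq_degreeRips]
  refine OrderHom.ext _ _ (funext fun p => ?_)
  have : (OrderHom.id.prodMap doubleScale) (subgrid n (1 / 2) p) = subgrid n 1 p := by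
    refine Prod.ext rfl ?_
    change 2 * (1 / 2 * (scaleB n p.2).toNNReal) = 1 * (scaleB n p.2).toNNReal
    rw [← mul_assoc]
    norm_num
  exact congrArg (degreeRips (witnessSet n)) this

end Cech

/-! ### Assembly and super-polynomial growth -/

section Conclusion

/-- Each coordinate of a supremum of grid points comes from one of them. This is what lets the rank
computation run in the full poset. -/
theorem subgrid_sup_le (n : ℕ) (c : ℝ≥0) (a b : Fin (n + 2) × Fin (n + 2)) (p : ℤᵒᵈ × ℝ≥0)
    (ha : subgrid n c a ≤ p) (hb : subgrid n c b ≤ p) : subgrid n c (a ⊔ b) ≤ p := by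
  have e1 : ∀ {x y : Fin (n + 2) × Fin (n + 2)}, x.1 = y.1 →
      (subgrid n c x).1 = (subgrid n c y).1 := fun h =>
    congrArg (fun i : Fin (n + 2) => OrderDual.toDual ((n : ℤ) + 4 - (i : ℕ))) h
  have e2 : ∀ {x y : Fin (n + 2) × Fin (n + 2)}, x.2 = y.2 →
      (subgrid n c x).2 = (subgrid n c y).2 := fun h =>
    congrArg (fun j : Fin (n + 2) => c * (scaleB n j).toNNReal) h
  constructor
  · rcases le_total a.1 b.1 with h | h
    · exact (e1 (sup_eq_right.mpr h)).trans_le hb.1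
    · exact (e1 (sup_eq_left.mpr h)).trans_le ha.1
  · rcases le_total a.2 b.2 with h | h
    · exact (e2 (sup_eq_right.mpr h)).trans_le hb.2
    · exact (e2 (sup_eq_left.mpr h)).trans_le ha.2

/-- Both degree bifiltrations of the witness have the asserted properties. -/
theorem witness_properties (F : Type*) [Field F] {n : ℕ} (hn : 2 ≤ n)
    (K : ℝ≥0 →o PreAbstractSimplicialComplex (witnessSet n)) (c : ℝ≥0)
    (hK : (degreeBifiltration K).comp (subgrid n c) = witnessFiltration n) :
    HasZigzagStructure n
        ((filtrationHomology F (degreeBifiltration K) 1).restrict (subgrid n c)) ∧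
      2 ^ (n + 1) - 1 ≤ gpdSize
        ((filtrationHomology F (degreeBifiltration K) 1).restrict (subgrid n c)) ∧
      (∃ f, IsGPD (filtrationHomology F (degreeBifiltration K) 1) f ∧
        (Function.support f).Finite) ∧
      2 ^ (n + 1) - 1 ≤ gpdSize (filtrationHomology F (degreeBifiltration K) 1) := by
  have hz : HasZigzagStructure n
      ((filtrationHomology F (degreeBifiltration K) 1).restrict (subgrid n c)) := by
    change HasZigzagStructure n
      (filtrationHomology F ((degreeBifiltration K).comp (subgrid n c)) 1)
    rw [hK]
    exact hasZigzagStructure_witnessFiltration F hn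
  have hgpd := exists_isGPD_degreeBifiltration F K 1
  exact ⟨hz, hz.two_pow_le_gpdSize, hgpd, two_pow_le_gpdSize (subgrid_sup_le n c) hz hgpd⟩

/-- Exponential growth along sets of quadratic cardinality is not polynomial. -/
theorem not_polynomially_bounded (size : ℕ → ℕ) (h : ∀ n, 2 ≤ n → 2 ^ (n + 1) - 1 ≤ size n) (k : ℕ)
    (C : ℝ) (N₀ : ℕ) : ¬ ∀ n : ℕ, 2 ≤ n → N₀ ≤ 4 * (n + 1) * (n + 2) →
      (size n : ℝ) ≤ C * ((4 * (n + 1) * (n + 2) : ℕ) : ℝ) ^ k := by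
  intro hbound
  -- The factor `4 ^ k` comes from `4 (n + 1) (n + 2) ≤ 4 (n + 2)²`, the leading `4` from passing
  -- from `2 ^ n` to `2 ^ (n + 2)`; the quadratic cardinality turns the exponent `k` into `2 * k`.
  set D : ℝ := 4 * (|C| * 4 ^ k) with hD
  have hD0 : 0 ≤ D := by positivity
  have hlim := tendsto_pow_const_div_const_pow_of_one_lt (2 * k) (one_lt_two : (1 : ℝ) < 2)
  have hev := hlim.eventually (gt_mem_nhds (show (0 : ℝ) < 1 / (D + 1) by positivity))
  -- With `m = n + 2`, the bound `N₀ + 4` ensures both `2 ≤ n` and that the cardinality is at least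
  -- `N₀`.
  obtain ⟨m, hm, hm'⟩ := (hev.and (Filter.eventually_ge_atTop (N₀ + 4))).exists
  obtain ⟨n, rfl⟩ : ∃ n, m = n + 2 := ⟨m - 2, by omega⟩
  rw [div_lt_div_iff₀ (by positivity) (by positivity), one_mul] at hm
  have hn : 2 ≤ n := by omega
  have h1 := hbound n hn (by nlinarith)
  have h2 : (2 : ℝ) ^ n ≤ size n := by
    have := h n hn
    have hpos : 1 ≤ 2 ^ n := Nat.one_le_two_pow
    have h3 : 2 ^ n ≤ size n := by
      rw [pow_succ] at this
      omega
    exact_mod_cast h3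
  have h4 : (((4 * (n + 1) * (n + 2) : ℕ) : ℝ)) ^ k ≤ 4 ^ k * ((n + 2 : ℕ) : ℝ) ^ (2 * k) := by
    rw [pow_mul, ← mul_pow]
    refine pow_le_pow_left₀ (by positivity) ?_ k
    push_cast
    nlinarith [(Nat.cast_nonneg n : (0 : ℝ) ≤ n)]
  have h5 : (2 : ℝ) ^ (n + 2) ≤ D * ((n + 2 : ℕ) : ℝ) ^ (2 * k) := by
    have h6 : C * (((4 * (n + 1) * (n + 2) : ℕ) : ℝ)) ^ k ≤
        |C| * (4 ^ k * ((n + 2 : ℕ) : ℝ) ^ (2 * k)) :=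
      mul_le_mul (le_abs_self C) h4 (by positivity) (abs_nonneg C)
    rw [pow_add, hD]
    linarith
  have h7 : 0 ≤ ((n + 2 : ℕ) : ℝ) ^ (2 * k) := by positivity
  linarith

end Conclusion

theorem mainTheorem3 (F : Type*) [Field F] :
    -- degree-Rips: the sizes over all finite metric spaces are not polynomially bounded
    (¬ ∃ (k : ℕ) (C : ℝ) (N₀ : ℕ), ∀ (X : Type) [MetricSpace X] [Finite X], N₀ ≤ Nat.card X →
      (gpdSize (filtrationHomology F (degreeRips X) 1) : ℝ) ≤ C * (Nat.card X : ℝ) ^ k) ∧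
    -- degree-Čech: the same, already over finite subsets of `ℝ³` with the supremum metric
    (¬ ∃ (k : ℕ) (C : ℝ) (N₀ : ℕ), ∀ X : Finset (Fin 3 → ℝ), N₀ ≤ X.card →
      (gpdSize (filtrationHomology F (degreeCech X) 1) : ℝ) ≤ C * (X.card : ℝ) ^ k) ∧
    -- explicit witnesses
    (∀ n : ℕ, 2 ≤ n →
      (witnessSet n).card = 4 * (n + 1) * (n + 2) ∧
      (HasZigzagStructure n
          ((filtrationHomology F (degreeRips (witnessSet n)) 1).restrict (subgrid n 1)) ∧
        2 ^ (n + 1) - 1 ≤ gpdSize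
          ((filtrationHomology F (degreeRips (witnessSet n)) 1).restrict (subgrid n 1)) ∧
        (∃ f, IsGPD (filtrationHomology F (degreeRips (witnessSet n)) 1) f ∧
          (Function.support f).Finite) ∧
        2 ^ (n + 1) - 1 ≤ gpdSize (filtrationHomology F (degreeRips (witnessSet n)) 1)) ∧
      (HasZigzagStructure n
          ((filtrationHomology F (degreeCech (witnessSet n)) 1).restrict (subgrid n (1 / 2))) ∧
        2 ^ (n + 1) - 1 ≤ gpdSize
          ((filtrationHomology F (degreeCech (witnessSet n)) 1).restrict (subgrid n (1 / 2))) ∧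
        (∃ f, IsGPD (filtrationHomology F (degreeCech (witnessSet n)) 1) f ∧
          (Function.support f).Finite) ∧
        2 ^ (n + 1) - 1 ≤ gpdSize (filtrationHomology F (degreeCech (witnessSet n)) 1))) := by
  have hrips : ∀ n : ℕ, 2 ≤ n → _ := fun n hn =>
    witness_properties F hn (ripsFiltration (witnessSet n)) 1 rfl
  have hcech : ∀ n : ℕ, 2 ≤ n → _ := fun n hn =>
    witness_properties F hn (cechFiltration (witnessSet n)) (1 / 2) (degreeCech_comp_subgrid n)
  refine ⟨?_, ?_, fun n hn => ⟨card_witnessSet hn, hrips n hn, hcech n hn⟩⟩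
  · rintro ⟨k, C, N₀, h⟩
    refine not_polynomially_bounded _ (fun n hn => (hrips n hn).2.2.2) k C N₀ fun n hn hN => ?_
    have hcard : Nat.card (witnessSet n) = 4 * (n + 1) * (n + 2) := by
      rw [Nat.card_eq_fintype_card, Fintype.card_coe, card_witnessSet hn]
    rw [← hcard] at hN ⊢
    exact h (witnessSet n) hN
  · rintro ⟨k, C, N₀, h⟩
    refine not_polynomially_bounded _ (fun n hn => (hcech n hn).2.2.2) k C N₀ fun n hn hN => ?_
    rw [← card_witnessSet hn] at hN ⊢
    exact h (witnessSet n) hN
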